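/- Let $q=e^{2\pi i/3}$. Let $A(SL_q(2))$ be the complex Hopf algebra generated by the entries of $(T_{ij})=\begin{pmatrix}a&b\\c&d\end{pmatrix}$ with relations $$ab=q\,ba,\quad ac=q\,ca,\quad bd=q\,db,\quad bc=cb,\quad cd=q\,dc,\quad ad-da=(q-q^{-1})bc,\quad ad-q\,bc=da-q^{-1}bc=1,$$ comultiplication $\Delta(T_{ij})=\sum_k T_{ik}\otimes T_{kj}$, counit $\varepsilon(T_{ij})=\delta_{ij}$ and antipode $S(a)=d$, $S(b)=-q^{-1}b$, $S(c)=-qc$, $S(d)=a$. Let $A(F)=A(SL_q(2))/\langle T_{ij}^3-\delta_{ij}\rangle$ be its quotient Hopf algebra, with canonical surjection $\pi_F$, and let $A(F)$ coact on $A(SL_q(2))$ from the right by $\Delta_R=(\mathrm{id}\otimes\pi_F)\circ\Delta$. Write $A(SL_q(2))^{co A(F)}=\{p : \Delta_R(p)=p\otimes 1\}$. Let $A(SL(2,\mathbb C))$ be the algebra of polynomial functions on $SL(2,\mathbb C)$, generated by the matrix coefficients $\bar T_{ij}$. Then there is a unique algebra homomorphism $Fr: A(SL(2,\mathbb C))\to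 A(SL_q(2))$ with $Fr(\bar T_{ij})=T_{ij}^3$ for $i,j\in\{1,2\}$ (the Frobenius map). It is injective, and its image $B:=Fr(A(SL(2,\mathbb C)))$ is exactly the subalgebra $A(SL_q(2))^{co A(F)}$ of right coinvariants. Moreover, there is a unique linear map $s:A(SL_q(2))\to B$ such that, for all $p,r,t,k,l,m\in\mathbb N_0$ with $m>0$, $$s(a^pb^rc^t)=\begin{cases}a^pb^rc^t & \text{if } 3\mid p,\ 3\mid r,\ 3\mid t,\\ 0&\text{otherwise,}\end{cases}\qquad s(b^kc^ld^m)=\begin{cases}b^kc^ld^m & \text{if } 3\mid k,\ 3\mid l,\ 3\mid m,\\ 0&\text{otherwise.}\end{cases}$$ It satisfies $s(1)=1$ and is a homomorphism of left and of right $B$-modules: $s(fx)=f\,s(x)$ and $s(xf)=s(x)f$ for all $f\in B$, $x\in A(SL_q(2))$. Consequently $A(SL_q(2))=B\oplus(\mathrm{id}-s)A(SL_q(2))$ as $B$-modules. -/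

import Mathlib

open scoped TensorProduct

noncomputable section

namespace QuantumSL2

/-! ### The algebra `A(SL_q(2))` -/

/-- The free generator in position `(i, j)` of the matrix `(T_ij) = (a b; c d)`. -/
abbrev X (i j : Fin 2) : FreeAlgebra ℂ (Fin 2 × Fin 2) := FreeAlgebra.ι ℂ (i, j)

/-- The defining relations of `A(SL_q(2))`, with `a = X 0 0`, `b = X 0 1`, `c = X 1 0`,
`d = X 1 1`. -/
inductive Rel (q : ℂˣ) : FreeAlgebra ℂ (Fin 2 × Fin 2) → FreeAlgebra ℂ (Fin 2 × Fin 2) → Prop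
  | ab : Rel q (X 0 0 * X 0 1) ((q : ℂ) • (X 0 1 * X 0 0))
  | ac : Rel q (X 0 0 * X 1 0) ((q : ℂ) • (X 1 0 * X 0 0))
  | bd : Rel q (X 0 1 * X 1 1) ((q : ℂ) • (X 1 1 * X 0 1))
  | bc : Rel q (X 0 1 * X 1 0) (X 1 0 * X 0 1)
  | cd : Rel q (X 1 0 * X 1 1) ((q : ℂ) • (X 1 1 * X 1 0))
  | comm : Rel q (X 0 0 * X 1 1 - X 1 1 * X 0 0) (((q : ℂ) - (q : ℂ)⁻¹) • (X 0 1 * X 1 0))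
  | det : Rel q (X 0 0 * X 1 1 - (q : ℂ) • (X 0 1 * X 1 0)) 1
  | det' : Rel q (X 1 1 * X 0 0 - (q : ℂ)⁻¹ • (X 0 1 * X 1 0)) 1

/-- The algebra `A(SL_q(2))`: the free complex algebra on `a, b, c, d` modulo the relations. -/
def SLq (q : ℂˣ) : Type := RingQuot (Rel q)

instance (q : ℂˣ) : Ring (SLq q) := inferInstanceAs (Ring (RingQuot (Rel q)))

instance (q : ℂˣ) : Algebra ℂ (SLq q) := inferInstanceAs (Algebra ℂ (RingQuot (Rel q)))

/-- The quotient map from the free algebra. -/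
def mk (q : ℂˣ) : FreeAlgebra ℂ (Fin 2 × Fin 2) →ₐ[ℂ] SLq q := RingQuot.mkAlgHom ℂ (Rel q)

/-- The generator `T_ij` of `A(SL_q(2))`. -/
def T (q : ℂˣ) (i j : Fin 2) : SLq q := mk q (X i j)

lemma mk_rel {q : ℂˣ} {x y : FreeAlgebra ℂ (Fin 2 × Fin 2)} (h : Rel q x y) :
    mk q x = mk q y := RingQuot.mkAlgHom_rel ℂ h

section relations

variable (q : ℂˣ)

lemma T_ba : T q 0 1 * T q 0 0 = (q : ℂ)⁻¹ • (T q 0 0 * T q 0 1) := by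
  have h := mk_rel (Rel.ab (q := q))
  simp only [map_mul, map_smul] at h
  rw [T, T, h, smul_smul, inv_mul_cancel₀ q.ne_zero, one_smul]

lemma T_ca : T q 1 0 * T q 0 0 = (q : ℂ)⁻¹ • (T q 0 0 * T q 1 0) := by
  have h := mk_rel (Rel.ac (q := q))
  simp only [map_mul, map_smul] at h
  rw [T, T, h, smul_smul, inv_mul_cancel₀ q.ne_zero, one_smul]

lemma T_db : T q 1 1 * T q 0 1 = (q : ℂ)⁻¹ • (T q 0 1 * T q 1 1) := by
  have h := mk_rel (Rel.bd (q := q))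
  simp only [map_mul, map_smul] at h
  rw [T, T, h, smul_smul, inv_mul_cancel₀ q.ne_zero, one_smul]

lemma T_dc : T q 1 1 * T q 1 0 = (q : ℂ)⁻¹ • (T q 1 0 * T q 1 1) := by
  have h := mk_rel (Rel.cd (q := q))
  simp only [map_mul, map_smul] at h
  rw [T, T, h, smul_smul, inv_mul_cancel₀ q.ne_zero, one_smul]

lemma T_cb : T q 1 0 * T q 0 1 = T q 0 1 * T q 1 0 := by
  have h := mk_rel (Rel.bc (q := q))
  simp only [map_mul] at h
  exact h.symm

lemma T_ad : T q 0 0 * T q 1 1 = 1 + (q : ℂ) • (T q 0 1 * T q 1 0) := by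
  have h := mk_rel (Rel.det (q := q))
  simp only [map_mul, map_smul, map_sub, map_one] at h
  exact sub_eq_iff_eq_add.1 h

lemma T_da : T q 1 1 * T q 0 0 = 1 + (q : ℂ)⁻¹ • (T q 0 1 * T q 1 0) := by
  have h := mk_rel (Rel.det' (q := q))
  simp only [map_mul, map_smul, map_sub, map_one] at h
  exact sub_eq_iff_eq_add.1 h

end relations

/-- Algebra maps out of `A(SL_q(2))`: images of the generators that satisfy the relations. -/
def lift (q : ℂˣ) {R : Type*} [Ring R] [Algebra ℂ R] (t : Fin 2 → Fin 2 → R)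
    (ab : t 0 0 * t 0 1 = (q : ℂ) • (t 0 1 * t 0 0))
    (ac : t 0 0 * t 1 0 = (q : ℂ) • (t 1 0 * t 0 0))
    (bd : t 0 1 * t 1 1 = (q : ℂ) • (t 1 1 * t 0 1))
    (bc : t 0 1 * t 1 0 = t 1 0 * t 0 1)
    (cd : t 1 0 * t 1 1 = (q : ℂ) • (t 1 1 * t 1 0))
    (det : t 0 0 * t 1 1 = 1 + (q : ℂ) • (t 0 1 * t 1 0))
    (det' : t 1 1 * t 0 0 = 1 + (q : ℂ)⁻¹ • (t 0 1 * t 1 0)) : SLq q →ₐ[ℂ] R :=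
  RingQuot.liftAlgHom ℂ ⟨FreeAlgebra.lift ℂ fun p => t p.1 p.2, by
    rintro _ _ (_ | _)
    · simpa using ab
    · simpa using ac
    · simpa using bd
    · simpa using bc
    · simpa using cd
    · simp only [map_sub, map_mul, FreeAlgebra.lift_ι_apply, map_smul, det, det']
      module
    · simp [det]
    · simp [det']⟩

lemma lift_T (q : ℂˣ) {R : Type*} [Ring R] [Algebra ℂ R] (t : Fin 2 → Fin 2 → R)
    (ab ac bd bc cd det det') (i j : Fin 2) :
    lift q t ab ac bd bc cd det det' (T q i j) = t i j := by
  have : lift q t ab ac bd bc cd det det' (T q i j) = FreeAlgebra.lift ℂ (fun p => t p.1 p.2)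
      (X i j) := RingQuot.liftAlgHom_mkAlgHom_apply ..
  rw [this, FreeAlgebra.lift_ι_apply]

lemma algHom_ext {q : ℂˣ} {R : Type*} [Semiring R] [Algebra ℂ R] {f g : SLq q →ₐ[ℂ] R}
    (h : ∀ i j, f (T q i j) = g (T q i j)) : f = g :=
  RingQuot.ringQuot_ext' ℂ f g (FreeAlgebra.hom_ext (funext fun p => h p.1 p.2))

lemma induction {q : ℂˣ} {C : SLq q → Prop} (hs : ∀ r : ℂ, C (algebraMap ℂ (SLq q) r))
    (hT : ∀ i j, C (T q i j)) (hm : ∀ x y, C x → C y → C (x * y))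
    (ha : ∀ x y, C x → C y → C (x + y)) (x : SLq q) : C x := by
  obtain ⟨x, rfl⟩ : ∃ y, mk q y = x := RingQuot.mkAlgHom_surjective ℂ (Rel q) x
  induction x using FreeAlgebra.induction with
  | grade0 r => rw [AlgHom.commutes]; exact hs r
  | grade1 p => exact hT p.1 p.2
  | mul x y hx hy => rw [map_mul]; exact hm _ _ hx hy
  | add x y hx hy => rw [map_add]; exact ha _ _ hx hy

/-! ### The Hopf algebra structure of `A(SL_q(2))` -/

/-- The comultiplication `Δ(T_ij) = ∑ₖ T_ik ⊗ T_kj`. -/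
def comulHom (q : ℂˣ) : SLq q →ₐ[ℂ] SLq q ⊗[ℂ] SLq q := by
  have hq := q.ne_zero
  refine lift q (fun i j => ∑ k, T q i k ⊗ₜ[ℂ] T q k j) ?_ ?_ ?_ ?_ ?_ ?_ ?_ <;>
  · simp only [Fin.sum_univ_two, add_mul, mul_add, Algebra.TensorProduct.tmul_mul_tmul, T_ba, T_ca,
      T_db, T_dc, T_cb, T_ad, T_da, TensorProduct.tmul_add, TensorProduct.add_tmul,
      TensorProduct.tmul_smul, ← TensorProduct.smul_tmul', Algebra.TensorProduct.one_def]
    match_scalars <;> field_simp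

lemma comulHom_T (q : ℂˣ) (i j : Fin 2) :
    comulHom q (T q i j) = ∑ k, T q i k ⊗ₜ[ℂ] T q k j := lift_T ..

/-- The counit `ε(T_ij) = δ_ij`. -/
def counitHom (q : ℂˣ) : SLq q →ₐ[ℂ] ℂ :=
  lift q (fun i j => (1 : Matrix (Fin 2) (Fin 2) ℂ) i j)
    (by simp) (by simp) (by simp) (by simp) (by simp) (by simp) (by simp)

lemma counitHom_T (q : ℂˣ) (i j : Fin 2) :
    counitHom q (T q i j) = (1 : Matrix (Fin 2) (Fin 2) ℂ) i j := lift_T ..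

/-- The antipode `S(a) = d`, `S(b) = -q⁻¹ b`, `S(c) = -q c`, `S(d) = a`, as an algebra map into
the opposite algebra. -/
def antipodeHom (q : ℂˣ) : SLq q →ₐ[ℂ] (SLq q)ᵐᵒᵖ := by
  have hq := q.ne_zero
  refine lift q (fun i j => MulOpposite.op
    (!![T q 1 1, -(q : ℂ)⁻¹ • T q 0 1; -(q : ℂ) • T q 1 0, T q 0 0] i j)) ?_ ?_ ?_ ?_ ?_ ?_ ?_ <;>
  · simp only [← MulOpposite.op_mul, ← MulOpposite.op_smul, ← MulOpposite.op_one,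
      ← MulOpposite.op_add, MulOpposite.op_inj, Matrix.of_apply, Matrix.cons_val',
      Matrix.cons_val_zero, Matrix.cons_val_one, Matrix.cons_val_fin_one, smul_mul_assoc,
      mul_smul_comm, T_ba, T_ca, T_db, T_dc, T_cb, T_ad, T_da]
    match_scalars <;> field_simp

/-- The antipode as a linear map. -/
def antipodeLin (q : ℂˣ) : SLq q →ₗ[ℂ] SLq q :=
  (MulOpposite.opLinearEquiv ℂ).symm.toLinearMap ∘ₗ (antipodeHom q).toLinearMap

lemma antipodeLin_T (q : ℂˣ) (i j : Fin 2) : antipodeLin q (T q i j) =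
    !![T q 1 1, -(q : ℂ)⁻¹ • T q 0 1; -(q : ℂ) • T q 1 0, T q 0 0] i j := by
  have : antipodeHom q (T q i j) = _ := lift_T ..
  simp [antipodeLin, this]

lemma antipodeLin_one (q : ℂˣ) : antipodeLin q 1 = 1 := by simp [antipodeLin]

lemma antipodeLin_mul (q : ℂˣ) (x y : SLq q) :
    antipodeLin q (x * y) = antipodeLin q y * antipodeLin q x := by simp [antipodeLin]

instance (q : ℂˣ) : Bialgebra ℂ (SLq q) := .ofAlgHom (comulHom q) (counitHom q)
  (algHom_ext fun i j => by
    simp [comulHom_T, TensorProduct.tmul_add, TensorProduct.add_tmul, Fin.sum_univ_two]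
    abel)
  (algHom_ext fun i j => by
    fin_cases i <;> fin_cases j <;> simp [comulHom_T, counitHom_T])
  (algHom_ext fun i j => by
    fin_cases i <;> fin_cases j <;> simp [comulHom_T, counitHom_T])

lemma comul_T (q : ℂˣ) (i j : Fin 2) : Coalgebra.comul (R := ℂ) (T q i j) =
    ∑ k, T q i k ⊗ₜ[ℂ] T q k j := comulHom_T q i j

lemma counit_T (q : ℂˣ) (i j : Fin 2) : Coalgebra.counit (R := ℂ) (T q i j) =
    (1 : Matrix (Fin 2) (Fin 2) ℂ) i j := counitHom_T q i j

lemma left_antipode (q : ℂˣ) (x : SLq q) :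
    LinearMap.mul' ℂ _ ((antipodeLin q).rTensor _ (Coalgebra.comul (R := ℂ) x)) =
      algebraMap ℂ _ (Coalgebra.counit (R := ℂ) x) := by
  set φ := LinearMap.mul' ℂ (SLq q) ∘ₗ (antipodeLin q).rTensor (SLq q) with hφ
  have h1 : ∀ z u v, φ (z * u ⊗ₜ v) = antipodeLin q u * φ z * v := by
    intro z u v
    induction z with
    | zero => simp
    | tmul a b => simp [φ, antipodeLin_mul, mul_assoc]
    | add a b ha hb => rw [add_mul, map_add, ha, hb, map_add]; noncomm_ring
  change φ _ = _
  induction x using induction with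
  | hs r => simp [φ, Algebra.algebraMap_eq_smul_one, Algebra.TensorProduct.one_def, antipodeLin_one]
  | hT i j =>
    have hq := q.ne_zero
    fin_cases i <;> fin_cases j <;>
      simp [φ, comul_T, counit_T, antipodeLin_T, T_ad, T_da, T_ca, T_cb, T_db, smul_smul, hq]
  | ha x y hx hy => simp [hx, hy]
  | hm x y hx hy =>
    have h2 : ∀ w, φ (Coalgebra.comul (R := ℂ) x * w) = Coalgebra.counit (R := ℂ) x • φ w := by
      intro w
      induction w with
      | zero => simp
      | tmul a b =>
        rw [h1, hx, ← Algebra.commutes, mul_assoc, ← Algebra.smul_def]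
        simp [φ]
      | add a b ha hb => rw [mul_add, map_add, ha, hb, map_add, smul_add]
    rw [Bialgebra.comul_mul, h2, hy, Bialgebra.counit_mul, map_mul, Algebra.smul_def]

lemma right_antipode (q : ℂˣ) (x : SLq q) :
    LinearMap.mul' ℂ _ ((antipodeLin q).lTensor _ (Coalgebra.comul (R := ℂ) x)) =
      algebraMap ℂ _ (Coalgebra.counit (R := ℂ) x) := by
  set φ := LinearMap.mul' ℂ (SLq q) ∘ₗ (antipodeLin q).lTensor (SLq q) with hφ
  have h1 : ∀ z u v, φ (u ⊗ₜ v * z) = u * φ z * antipodeLin q v := by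
    intro z u v
    induction z with
    | zero => simp
    | tmul a b => simp [φ, antipodeLin_mul, mul_assoc]
    | add a b ha hb => rw [mul_add, map_add, ha, hb, map_add]; noncomm_ring
  change φ _ = _
  induction x using induction with
  | hs r => simp [φ, Algebra.algebraMap_eq_smul_one, Algebra.TensorProduct.one_def, antipodeLin_one]
  | hT i j =>
    have hq := q.ne_zero
    fin_cases i <;> fin_cases j <;>
      simp [φ, comul_T, counit_T, antipodeLin_T, T_ad, T_da, T_ba, T_cb, T_dc, smul_smul, hq]
  | ha x y hx hy => simp [hx, hy]
  | hm x y hx hy =>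
    have h2 : ∀ w, φ (w * Coalgebra.comul (R := ℂ) y) = Coalgebra.counit (R := ℂ) y • φ w := by
      intro w
      induction w with
      | zero => simp
      | tmul a b =>
        rw [h1, hy, ← Algebra.commutes, mul_assoc, ← Algebra.smul_def]
        simp [φ]
      | add a b ha hb => rw [add_mul, map_add, ha, hb, map_add, smul_add]
    rw [Bialgebra.comul_mul, h2, hx, Bialgebra.counit_mul, map_mul, Algebra.smul_def,
      Algebra.commutes]

instance (q : ℂˣ) : HopfAlgebra ℂ (SLq q) where
  antipode := antipodeLin q
  mul_antipode_rTensor_comul := LinearMap.ext (left_antipode q)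
  mul_antipode_lTensor_comul := LinearMap.ext (right_antipode q)

/-! ### The cubic root of unity and the finite quantum group `F` -/

/-- The cubic root of unity `e^{2πi/3}`. -/
def zeta : ℂˣ := Units.mk0 (Complex.exp (2 * Real.pi * Complex.I / 3)) (Complex.exp_ne_zero _)

lemma zeta_primitive : IsPrimitiveRoot (zeta : ℂ) 3 := by
  exact Complex.isPrimitiveRoot_exp 3 (by norm_num)

lemma zeta_sum : 1 + ((zeta : ℂ)⁻¹) ^ 2 + (((zeta : ℂ)⁻¹) ^ 2) ^ 2 = 0 := by
  have h := zeta_primitive.geom_sum_eq_zero (by norm_num)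
  simp only [Finset.sum_range_succ, Finset.sum_range_zero] at h
  have h3 := zeta_primitive.pow_eq_one
  have h0 : (zeta : ℂ) ≠ 0 := zeta.ne_zero
  field_simp
  linear_combination h + (zeta : ℂ) * h3

/-- The quantum group algebra `A(SL_q(2))` at `q = e^{2πi/3}`. -/
abbrev P : Type := SLq zeta

/-- The two-sided ideal generated by the elements `T_ij³ - δ_ij`. -/
def ideal : TwoSidedIdeal P :=
  TwoSidedIdeal.span
    (Set.range fun p : Fin 2 × Fin 2 =>
      T zeta p.1 p.2 ^ 3 - algebraMap ℂ P ((1 : Matrix (Fin 2) (Fin 2) ℂ) p.1 p.2))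

/-- The algebra `A(F) = A(SL_q(2)) / ⟨T_ij³ - δ_ij⟩`. -/
abbrev AF : Type := P ⧸ ideal.asIdeal

/-- The canonical surjection `π_F : A(SL_q(2)) → A(F)`. -/
def proj : P →ₐ[ℂ] AF := Ideal.Quotient.mkₐ ℂ ideal.asIdeal

lemma ideal_le_ker {R : Type*} [Ring R] [Algebra ℂ R] (f : P →ₐ[ℂ] R)
    (h : ∀ i j, f (T zeta i j) ^ 3 = algebraMap ℂ R ((1 : Matrix (Fin 2) (Fin 2) ℂ) i j))
    {x : P} (hx : x ∈ ideal) : f x = 0 := by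
  have : ideal ≤ TwoSidedIdeal.ker f := by
    rw [ideal, TwoSidedIdeal.span_le]
    rintro _ ⟨p, rfl⟩
    simp [TwoSidedIdeal.mem_ker, h]
  exact (TwoSidedIdeal.mem_ker f).1 (this hx)

lemma proj_T_cube (i j : Fin 2) :
    proj (T zeta i j) ^ 3 = algebraMap ℂ AF ((1 : Matrix (Fin 2) (Fin 2) ℂ) i j) := by
  rw [← map_pow, ← proj.commutes, ← sub_eq_zero, ← map_sub]
  exact Ideal.Quotient.eq_zero_iff_mem.2 (TwoSidedIdeal.subset_span ⟨(i, j), rfl⟩)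

lemma add_cube {R : Type*} [Ring R] [Algebra ℂ R] {w : ℂ} (hw : 1 + w + w ^ 2 = 0) {u v : R}
    (h : v * u = w • (u * v)) : (u + v) ^ 3 = u ^ 3 + v ^ 3 := by
  have e1 : u * v * u = w • (u * u * v) := by rw [mul_assoc, h, mul_smul_comm, mul_assoc]
  have e2 : v * u * u = w ^ 2 • (u * u * v) := by rw [h, smul_mul_assoc, e1, smul_smul, sq]
  have e3 : v * u * v = w • (u * v * v) := by rw [h, smul_mul_assoc]
  have e4 : v * v * u = w ^ 2 • (u * v * v) := by
    rw [mul_assoc, h, mul_smul_comm, ← mul_assoc, e3, smul_smul, sq]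
  have e5 : (1 + w + w ^ 2) • (u * u * v) = 0 := by rw [hw, zero_smul]
  have e6 : (1 + w + w ^ 2) • (u * v * v) = 0 := by rw [hw, zero_smul]
  calc (u + v) ^ 3 = u ^ 3 + v ^ 3 + (u * u * v + u * v * u + v * u * u)
        + (u * v * v + v * u * v + v * v * u) := by noncomm_ring
    _ = u ^ 3 + v ^ 3 + (1 + w + w ^ 2) • (u * u * v) + (1 + w + w ^ 2) • (u * v * v) := by
        rw [e1, e2, e3, e4]; module
    _ = u ^ 3 + v ^ 3 := by rw [e5, e6, add_zero, add_zero]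

lemma comul_T_cube (i j : Fin 2) : comulHom zeta (T zeta i j) ^ 3 =
    ∑ k, (T zeta i k ^ 3) ⊗ₜ[ℂ] (T zeta k j ^ 3) := by
  rw [comulHom_T, Fin.sum_univ_two, Fin.sum_univ_two, add_cube zeta_sum]
  · simp only [Algebra.TensorProduct.tmul_pow]
  · have hr : ∀ i, T zeta i 1 * T zeta i 0 = (zeta : ℂ)⁻¹ • (T zeta i 0 * T zeta i 1) := by
      intro i; fin_cases i
      exacts [T_ba _, T_dc _]
    have hc : ∀ j, T zeta 1 j * T zeta 0 j = (zeta : ℂ)⁻¹ • (T zeta 0 j * T zeta 1 j) := by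
      intro i; fin_cases i
      exacts [T_ca _, T_db _]
    simp only [Algebra.TensorProduct.tmul_mul_tmul, hr, hc, TensorProduct.tmul_smul,
      ← TensorProduct.smul_tmul', smul_smul, sq]

instance : ideal.asIdeal.IsHopfIdeal ℂ where
  counit_eq_zero x hx := ideal_le_ker (counitHom zeta)
    (fun i j => by rw [counitHom_T]; fin_cases i <;> fin_cases j <;> simp) hx
  map_mkQ_comul_eq_zero x hx := by
    refine ideal_le_ker ((Algebra.TensorProduct.map proj proj).comp (comulHom zeta)) ?_ hx
    intro i j
    rw [AlgHom.comp_apply, ← map_pow, comul_T_cube, map_sum]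
    simp only [Algebra.TensorProduct.map_tmul, map_pow, proj_T_cube]
    revert i j
    simp [Fin.forall_fin_two]
  antipode_mem x hx := by
    have h : ((AlgHom.op proj).comp (antipodeHom zeta)) x = 0 := by
      refine ideal_le_ker _ ?_ hx
      intro i j
      have h1 : antipodeHom zeta (T zeta i j) = _ := lift_T ..
      rw [AlgHom.comp_apply, h1]
      fin_cases i <;> fin_cases j <;>
        simp [← MulOpposite.op_pow, smul_pow, Odd.neg_pow (by decide : Odd 3), proj_T_cube]
    exact Ideal.Quotient.eq_zero_iff_mem.1 (MulOpposite.op_injective h)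

/-! ### The coaction of `A(F)` and its coinvariants -/

/-- The right coaction `Δ_R = (id ⊗ π_F) ∘ Δ` of `A(F)` on `A(SL_q(2))`. -/
def coaction : P →ₐ[ℂ] P ⊗[ℂ] AF :=
  (Algebra.TensorProduct.map (AlgHom.id ℂ P) proj).comp (Bialgebra.comulAlgHom ℂ P)

/-- The subalgebra of right coinvariants `{p | Δ_R p = p ⊗ 1}`. -/
def coinvariants : Subalgebra ℂ P :=
  AlgHom.equalizer coaction Algebra.TensorProduct.includeLeft

lemma mem_coinvariants {p : P} : p ∈ coinvariants ↔ coaction p = p ⊗ₜ[ℂ] 1 := Iff.rfl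

/-! ### Polynomial functions on `SL(2, ℂ)`, the Frobenius map and the splitting -/

/-- The `(i, j)` matrix coefficient, as a function on the group `SL(2, ℂ)`. -/
def coeff (i j : Fin 2) : Matrix.SpecialLinearGroup (Fin 2) ℂ → ℂ := fun g => g.1 i j

/-- The algebra `A(SL(2, ℂ))` of polynomial functions on `SL(2, ℂ)`: the subalgebra of the
algebra of all functions that is generated by the matrix coefficients. -/
def polyFun : Subalgebra ℂ (Matrix.SpecialLinearGroup (Fin 2) ℂ → ℂ) :=
  Algebra.adjoin ℂ (Set.range fun p : Fin 2 × Fin 2 => coeff p.1 p.2)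

/-- The generator `T̄_ij` of `A(SL(2, ℂ))`. -/
def Tbar (i j : Fin 2) : polyFun := ⟨coeff i j, Algebra.subset_adjoin ⟨(i, j), rfl⟩⟩

/-- `Fr` is the Frobenius map: it sends `T̄_ij` to `T_ij³`. -/
def IsFrobenius (Fr : polyFun →ₐ[ℂ] P) : Prop :=
  ∀ i j, Fr (Tbar i j) = T zeta i j ^ 3

/-- The formulas that define the splitting: a monomial `a^p b^r c^t` or `b^k c^l d^m` with `m > 0`
is kept if all its exponents are divisible by `3`, and goes to `0` otherwise. -/
structure IsSplitting (B : Subalgebra ℂ P) (s : P →ₗ[ℂ] B) : Prop where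
  abc : ∀ p r t : ℕ, (s (T zeta 0 0 ^ p * T zeta 0 1 ^ r * T zeta 1 0 ^ t) : P) =
    if 3 ∣ p ∧ 3 ∣ r ∧ 3 ∣ t then T zeta 0 0 ^ p * T zeta 0 1 ^ r * T zeta 1 0 ^ t else 0
  bcd : ∀ k l m : ℕ, 0 < m → (s (T zeta 0 1 ^ k * T zeta 1 0 ^ l * T zeta 1 1 ^ m) : P) =
    if 3 ∣ k ∧ 3 ∣ l ∧ 3 ∣ m then T zeta 0 1 ^ k * T zeta 1 0 ^ l * T zeta 1 1 ^ m else 0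

end QuantumSL2

end

open scoped NNReal

noncomputable section

namespace QuantumSL2

/-! ### Elements that commute up to a scalar -/

/-! The proof rests on a basis. For every q the monomials `mon`, a^n b^r c^t and b^r c^t d^m, form a
basis of A(SL_q(2)) (`monBasis`). They span because their span contains 1 and absorbs each generator
on the left. For independence, take the representations on functions on ℤ in which b and c are
diagonal with parameters β and γ: the monomial of index (n, r, t) sends δ_0 to a nonzero multiple of
β^r γ^t δ_n, and Dedekind's theorem separates the characters s^n β^r γ^t.

When q is a primitive cube root of unity, the cubes of the generators are central
(`cube_mem_center`) and satisfy a³d³ = 1 + b³c³ (`cube_det`), so they obey the relations for q = 1.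
The resulting map `cubeHom` carries the basis at q = 1 bijectively onto the monomials all of whose
exponents are divisible by 3; in particular it is injective. The algebra at q = 1 is the algebra of
polynomial functions on SL(2, ℂ) (`classicalEquiv`), which gives the Frobenius map. The splitting is
the coordinate projection onto the same monomials. Its B-linearity reduces to multiplication by the
four cubes, and centrality makes left and right linearity equivalent.

The q-binomial formula makes the cubes coinvariant (`comul_T_cube`). Conversely, two-dimensional
triangular representations of A(F) turn the coaction into a diagonal algebra map `torus` and two
skew derivations; the former fixes coinvariants and the latter kill them. On monomials the leading
coefficients of the derivations are q-integers up to nonzero factors, and these vanish exactly at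
multiples of 3. Comparing coefficients forces 3 to divide r and t, and `torus` then forces 3 to
divide n (`triple_of_mem_coinvariants`). -/

lemma pow_mul_of_skew {R : Type*} [Ring R] [Algebra ℂ R] {x y : R} {k : ℂ}
    (h : x * y = k • (y * x)) (n : ℕ) : x ^ n * y = k ^ n • (y * x ^ n) := by
  induction n with
  | zero => simp
  | succ n ih => rw [pow_succ, mul_assoc, h, mul_smul_comm, ← mul_assoc, ih, smul_mul_assoc,
      smul_smul, mul_assoc, pow_succ, mul_comm]

lemma mul_pow_of_skew {R : Type*} [Ring R] [Algebra ℂ R] {x y : R} {k : ℂ}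
    (h : x * y = k • (y * x)) (n : ℕ) : x * y ^ n = k ^ n • (y ^ n * x) := by
  induction n with
  | zero => simp
  | succ n ih => rw [pow_succ, ← mul_assoc, ih, smul_mul_assoc, mul_assoc, h, mul_smul_comm,
      smul_smul, mul_assoc, pow_succ]

section relations

variable (q : ℂˣ)

lemma T_ab : T q 0 0 * T q 0 1 = (q : ℂ) • (T q 0 1 * T q 0 0) := by
  rw [T_ba, smul_smul, mul_inv_cancel₀ q.ne_zero, one_smul]

lemma T_ac : T q 0 0 * T q 1 0 = (q : ℂ) • (T q 1 0 * T q 0 0) := by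
  rw [T_ca, smul_smul, mul_inv_cancel₀ q.ne_zero, one_smul]

lemma T_bd : T q 0 1 * T q 1 1 = (q : ℂ) • (T q 1 1 * T q 0 1) := by
  rw [T_db, smul_smul, mul_inv_cancel₀ q.ne_zero, one_smul]

lemma T_cd : T q 1 0 * T q 1 1 = (q : ℂ) • (T q 1 1 * T q 1 0) := by
  rw [T_dc, smul_smul, mul_inv_cancel₀ q.ne_zero, one_smul]

lemma commute_bc : Commute (T q 0 1) (T q 1 0) := (T_cb q).symm

/-- Moving `a` to the right of `b^r c^t`. -/
lemma a_mul_bc (r t : ℕ) : T q 0 0 * (T q 0 1 ^ r * T q 1 0 ^ t) =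
    (q : ℂ) ^ (r + t) • (T q 0 1 ^ r * T q 1 0 ^ t * T q 0 0) := by
  rw [← mul_assoc, mul_pow_of_skew (T_ab q), smul_mul_assoc, mul_assoc, mul_pow_of_skew (T_ac q),
    mul_smul_comm, smul_smul, ← mul_assoc, pow_add]

/-- Moving `d` to the right of `b^r c^t`. -/
lemma d_mul_bc (r t : ℕ) : T q 1 1 * (T q 0 1 ^ r * T q 1 0 ^ t) =
    (q : ℂ)⁻¹ ^ (r + t) • (T q 0 1 ^ r * T q 1 0 ^ t * T q 1 1) := by
  rw [← mul_assoc, mul_pow_of_skew (T_db q), smul_mul_assoc, mul_assoc, mul_pow_of_skew (T_dc q),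
    mul_smul_comm, smul_smul, ← mul_assoc, pow_add]

lemma b_mul_bc (r t : ℕ) : T q 0 1 * (T q 0 1 ^ r * T q 1 0 ^ t) =
    T q 0 1 ^ (r + 1) * T q 1 0 ^ t := by
  rw [← mul_assoc, pow_succ']

lemma c_mul_bc (r t : ℕ) : T q 1 0 * (T q 0 1 ^ r * T q 1 0 ^ t) =
    T q 0 1 ^ r * T q 1 0 ^ (t + 1) := by
  rw [← mul_assoc, ((commute_bc q).symm.pow_right r).eq, mul_assoc, ← pow_succ']

lemma bc_mul_bc (r t : ℕ) : T q 0 1 ^ r * T q 1 0 ^ t * (T q 0 1 * T q 1 0) =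
    T q 0 1 ^ (r + 1) * T q 1 0 ^ (t + 1) := by
  rw [mul_assoc, ← mul_assoc (T q 1 0 ^ t), ((commute_bc q).symm.pow_left t).eq, mul_assoc,
    ← mul_assoc, ← pow_succ, ← pow_succ]

/-! ### The monomials in normal form -/

/-- The monomial `a^n b^r c^t` for `n ≥ 0`, and `b^r c^t d^(-n)` for `n ≤ 0`. -/
def mon (i : ℤ × ℕ × ℕ) : SLq q :=
  T q 0 0 ^ i.1.toNat * (T q 0 1 ^ i.2.1 * T q 1 0 ^ i.2.2) * T q 1 1 ^ (-i.1).toNat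

lemma mon_natCast (n r t : ℕ) :
    mon q (n, r, t) = T q 0 0 ^ n * (T q 0 1 ^ r * T q 1 0 ^ t) := by simp [mon]

lemma mon_neg_natCast (n r t : ℕ) :
    mon q (-n, r, t) = T q 0 1 ^ r * T q 1 0 ^ t * T q 1 1 ^ n := by simp [mon]

-- The two case splits differ in the side that receives n = 0: multiplication by `a` is a plain
-- shift for n ≥ 0, multiplication by `d` is a scaled shift for n ≤ 0.
@[elab_as_elim]
lemma int_cases {C : ℤ → Prop} (h₁ : ∀ n : ℕ, C n) (h₂ : ∀ n : ℕ, C (-((n + 1 : ℕ) : ℤ)))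
    (n : ℤ) : C n := by
  cases n with
  | ofNat n => exact h₁ n
  | negSucc n => exact h₂ n

@[elab_as_elim]
lemma int_cases' {C : ℤ → Prop} (h₁ : ∀ n : ℕ, C (n + 1 : ℕ)) (h₂ : ∀ n : ℕ, C (-(n : ℤ)))
    (n : ℤ) : C n := by
  rcases n with n | n
  · cases n with
    | zero => exact h₂ 0
    | succ n => exact h₁ n
  · exact h₂ (n + 1)

lemma mon_zero : mon q 0 = 1 := by
  change mon q (0, 0, 0) = 1
  simp [mon]

lemma b_mul_mon (n : ℤ) (r t : ℕ) : ∃ k : ℂ, k ≠ 0 ∧ (n ≤ 0 → k = 1) ∧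
    T q 0 1 * mon q (n, r, t) = k • mon q (n, r + 1, t) := by
  induction n using int_cases' with
  | h₁ n =>
    refine ⟨(q : ℂ)⁻¹ ^ (n + 1), pow_ne_zero _ (inv_ne_zero q.ne_zero), by lia, ?_⟩
    rw [mon_natCast, mon_natCast, ← mul_assoc, mul_pow_of_skew (T_ba q), smul_mul_assoc, mul_assoc,
      b_mul_bc]
  | h₂ n =>
    refine ⟨1, one_ne_zero, fun _ => rfl, ?_⟩
    rw [mon_neg_natCast, mon_neg_natCast, ← mul_assoc, b_mul_bc, one_smul]

lemma c_mul_mon (n : ℤ) (r t : ℕ) : ∃ k : ℂ, k ≠ 0 ∧ (n ≤ 0 → k = 1) ∧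
    T q 1 0 * mon q (n, r, t) = k • mon q (n, r, t + 1) := by
  induction n using int_cases' with
  | h₁ n =>
    refine ⟨(q : ℂ)⁻¹ ^ (n + 1), pow_ne_zero _ (inv_ne_zero q.ne_zero), by lia, ?_⟩
    rw [mon_natCast, mon_natCast, ← mul_assoc, mul_pow_of_skew (T_ca q), smul_mul_assoc, mul_assoc,
      c_mul_bc]
  | h₂ n =>
    refine ⟨1, one_ne_zero, fun _ => rfl, ?_⟩
    rw [mon_neg_natCast, mon_neg_natCast, ← mul_assoc, c_mul_bc, one_smul]

lemma a_mul_mon_of_nonneg {n : ℤ} (hn : 0 ≤ n) (r t : ℕ) :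
    T q 0 0 * mon q (n, r, t) = mon q (n + 1, r, t) := by
  lift n to ℕ using hn
  rw [mon_natCast, ← Nat.cast_add_one, mon_natCast, ← mul_assoc, pow_succ']

/-- Here `a` passes b^r c^t, meets the first `d`, and ad = 1 + q bc produces the two terms. -/
lemma a_mul_mon_of_neg {n : ℤ} (hn : n < 0) (r t : ℕ) :
    T q 0 0 * mon q (n, r, t) = (q : ℂ) ^ (r + t) • mon q (n + 1, r, t) +
      (q : ℂ) ^ (r + t + 1) • mon q (n + 1, r + 1, t + 1) := by
  obtain ⟨m, rfl⟩ : ∃ m : ℕ, n = -(m + 1 : ℕ) := ⟨(-n - 1).toNat, by lia⟩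
  rw [show -((m + 1 : ℕ) : ℤ) + 1 = -(m : ℤ) by push_cast; ring, mon_neg_natCast, mon_neg_natCast,
    mon_neg_natCast, ← mul_assoc, a_mul_bc, pow_succ', smul_mul_assoc, mul_assoc,
    ← mul_assoc (T q 0 0), T_ad, ← mul_assoc, mul_add, mul_one, mul_smul_comm, bc_mul_bc, add_mul,
    smul_add, smul_mul_assoc, smul_smul, pow_succ (q : ℂ)]

lemma d_mul_mon_of_nonpos {n : ℤ} (hn : n ≤ 0) (r t : ℕ) :
    T q 1 1 * mon q (n, r, t) = (q : ℂ)⁻¹ ^ (r + t) • mon q (n - 1, r, t) := by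
  obtain ⟨m, rfl⟩ : ∃ m : ℕ, n = -m := ⟨(-n).toNat, by lia⟩
  rw [show -(m : ℤ) - 1 = -((m + 1 : ℕ) : ℤ) by push_cast; ring, mon_neg_natCast, mon_neg_natCast,
    ← mul_assoc, d_mul_bc, pow_succ', smul_mul_assoc, mul_assoc]

/-- Since da = 1 + q⁻¹ bc, the factor bc must still cross a^(n-1), which costs q^(-2(n-1)); together
this is q^(1-2n). -/
lemma d_mul_mon_of_pos {n : ℤ} (hn : 0 < n) (r t : ℕ) :
    T q 1 1 * mon q (n, r, t) = mon q (n - 1, r, t) +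
      ((q : ℂ) * (q : ℂ)⁻¹ ^ (2 * n.toNat)) • mon q (n - 1, r + 1, t + 1) := by
  obtain ⟨m, rfl⟩ : ∃ m : ℕ, n = (m + 1 : ℕ) := ⟨(n - 1).toNat, by lia⟩
  have h : T q 0 1 * T q 1 0 * T q 0 0 ^ m =
      (q : ℂ)⁻¹ ^ (2 * m) • (T q 0 0 ^ m * (T q 0 1 * T q 1 0)) := by
    rw [mul_assoc, mul_pow_of_skew (T_ca q), mul_smul_comm, ← mul_assoc, mul_pow_of_skew (T_ba q),
      smul_mul_assoc, smul_smul, ← pow_add, mul_assoc, two_mul]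
  have h' : T q 0 1 * T q 1 0 * (T q 0 1 ^ r * T q 1 0 ^ t) =
      T q 0 1 ^ (r + 1) * T q 1 0 ^ (t + 1) := by
    rw [mul_assoc, c_mul_bc, b_mul_bc]
  rw [show ((m + 1 : ℕ) : ℤ) - 1 = m by push_cast; ring, mon_natCast, mon_natCast,
    mon_natCast, pow_succ' (T q 0 0), ← mul_assoc (T q 1 1), ← mul_assoc (T q 1 1), T_da, add_mul,
    one_mul, smul_mul_assoc, h, smul_smul, add_mul, smul_mul_assoc,
    mul_assoc _ (T q 0 1 * T q 1 0), h']
  congr 2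
  have := q.ne_zero
  rw [Int.toNat_natCast, mul_add, pow_add, mul_one]
  field_simp

/-- The span of the monomials with a given exponent of `a` (or minus that of `d`). -/
def layer (n : ℤ) : Submodule ℂ (SLq q) :=
  Submodule.span ℂ (Set.range fun p : ℕ × ℕ => mon q (n, p.1, p.2))

lemma mon_mem_layer (n : ℤ) (r t : ℕ) : mon q (n, r, t) ∈ layer q n :=
  Submodule.subset_span ⟨(r, t), rfl⟩

lemma mul_mem_of_mon {n : ℤ} {S : Submodule ℂ (SLq q)} {y : SLq q}
    (h : ∀ r t, y * mon q (n, r, t) ∈ S) {x : SLq q} (hx : x ∈ layer q n) : y * x ∈ S := by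
  have : layer q n ≤ S.comap (LinearMap.mulLeft ℂ y) := by
    rw [layer, Submodule.span_le]
    rintro _ ⟨p, rfl⟩
    exact h p.1 p.2
  exact this hx

/-- The relations are homogeneous when a, d, b, c have degrees 1, -1, 0, 0. -/
lemma a_mul_mem_layer {n : ℤ} {x : SLq q} (hx : x ∈ layer q n) :
    T q 0 0 * x ∈ layer q (n + 1) := by
  refine mul_mem_of_mon q (fun r t => ?_) hx
  obtain hn | hn := le_or_gt 0 n
  · rw [a_mul_mon_of_nonneg q hn]
    exact mon_mem_layer _ _ _ _
  · rw [a_mul_mon_of_neg q hn]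
    exact add_mem (Submodule.smul_mem _ _ (mon_mem_layer _ _ _ _))
      (Submodule.smul_mem _ _ (mon_mem_layer _ _ _ _))

lemma d_mul_mem_layer {n : ℤ} {x : SLq q} (hx : x ∈ layer q n) :
    T q 1 1 * x ∈ layer q (n - 1) := by
  refine mul_mem_of_mon q (fun r t => ?_) hx
  obtain hn | hn := le_or_gt n 0
  · rw [d_mul_mon_of_nonpos q hn]
    exact Submodule.smul_mem _ _ (mon_mem_layer _ _ _ _)
  · rw [d_mul_mon_of_pos q hn]
    exact add_mem (mon_mem_layer _ _ _ _) (Submodule.smul_mem _ _ (mon_mem_layer _ _ _ _))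

lemma layer_le_span (n : ℤ) : layer q n ≤ Submodule.span ℂ (Set.range (mon q)) :=
  Submodule.span_mono (by rintro _ ⟨p, rfl⟩; exact ⟨_, rfl⟩)

/-- The span is stable under left multiplication by the generators, hence is a left ideal, and it
contains 1. -/
lemma span_mon : ⊤ ≤ Submodule.span ℂ (Set.range (mon q)) := by
  set S := Submodule.span ℂ (Set.range (mon q)) with hS
  have key : ∀ y : SLq q, (∀ i, y * mon q i ∈ S) → ∀ x ∈ S, y * x ∈ S := by
    intro y h
    have : S ≤ S.comap (LinearMap.mulLeft ℂ y) := by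
      refine Submodule.span_le.2 ?_
      rintro _ ⟨p, rfl⟩
      exact h p
    exact fun x hx => this hx
  have hmon : ∀ i, mon q i ∈ S := fun i => Submodule.subset_span ⟨i, rfl⟩
  have main : ∀ y x : SLq q, x ∈ S → y * x ∈ S := by
    intro y
    induction y using induction with
    | hs r => intro x hx; rw [← Algebra.smul_def]; exact S.smul_mem r hx
    | hT i j =>
      refine key _ fun ⟨n, r, t⟩ => ?_
      fin_cases i <;> fin_cases j
      · exact layer_le_span q _ (a_mul_mem_layer q (mon_mem_layer _ _ _ _))
      · obtain ⟨k, -, -, h⟩ := b_mul_mon q n r t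
        exact h ▸ S.smul_mem k (hmon _)
      · obtain ⟨k, -, -, h⟩ := c_mul_mon q n r t
        exact h ▸ S.smul_mem k (hmon _)
      · exact layer_le_span q _ (d_mul_mem_layer q (mon_mem_layer _ _ _ _))
    | hm x y hx hy => intro z hz; rw [mul_assoc]; exact hx _ (hy _ hz)
    | ha x y hx hy => intro z hz; rw [add_mul]; exact add_mem (hx _ hz) (hy _ hz)
  intro x _
  simpa using main x 1 (mon_zero q ▸ hmon 0)

end relations

/-! ### Linear independence of the monomials -/

section representation

variable (q : ℂˣ) (β γ : ℂ)

/-- The operators of the representation of `A(SL_q(2))` on finitely supported functions on `ℤ` in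
which `b` and `c` are diagonal, `a` raises and `d` lowers the degree. -/
def repOp (i j : Fin 2) : Module.End ℂ (ℤ →₀ ℂ) :=
  Finsupp.linearCombination ℂ fun n : ℤ =>
    !![Finsupp.single (n + 1) (if 0 ≤ n then 1 else 1 + (q : ℂ) ^ (-(2 * n + 1)) * (β * γ)),
       Finsupp.single n (β * (q : ℂ) ^ (-n));
       Finsupp.single n (γ * (q : ℂ) ^ (-n)),
       Finsupp.single (n - 1)
        (if n ≤ 0 then 1 else 1 + (q : ℂ) ^ (1 - 2 * n) * (β * γ))] i j

lemma repOp_a (n : ℤ) (z : ℂ) : repOp q β γ 0 0 (Finsupp.single n z) = Finsupp.single (n + 1)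
    (z * if 0 ≤ n then 1 else 1 + (q : ℂ) ^ (-(2 * n + 1)) * (β * γ)) := by
  rw [repOp, Finsupp.linearCombination_single]
  exact Finsupp.smul_single ..

lemma repOp_b (n : ℤ) (z : ℂ) : repOp q β γ 0 1 (Finsupp.single n z) =
    Finsupp.single n (z * (β * (q : ℂ) ^ (-n))) := by
  rw [repOp, Finsupp.linearCombination_single]
  exact Finsupp.smul_single ..

lemma repOp_c (n : ℤ) (z : ℂ) : repOp q β γ 1 0 (Finsupp.single n z) =
    Finsupp.single n (z * (γ * (q : ℂ) ^ (-n))) := by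
  rw [repOp, Finsupp.linearCombination_single]
  exact Finsupp.smul_single ..

lemma repOp_d (n : ℤ) (z : ℂ) : repOp q β γ 1 1 (Finsupp.single n z) = Finsupp.single (n - 1)
    (z * if n ≤ 0 then 1 else 1 + (q : ℂ) ^ (1 - 2 * n) * (β * γ)) := by
  rw [repOp, Finsupp.linearCombination_single]
  exact Finsupp.smul_single ..

/-- The representation of `A(SL_q(2))` given by `repOp`. -/
def rep : SLq q →ₐ[ℂ] Module.End ℂ (ℤ →₀ ℂ) := by
  have hq := q.ne_zero
  refine lift q (repOp q β γ) ?_ ?_ ?_ ?_ ?_ ?_ ?_ <;> refine Finsupp.lhom_ext fun n z => ?_ <;>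
    simp only [Module.End.mul_apply, LinearMap.smul_apply, LinearMap.add_apply,
      Module.End.one_apply, repOp_a, repOp_b, repOp_c, repOp_d, Finsupp.smul_single, smul_eq_mul,
      sub_add_cancel, add_sub_cancel_right, ← Finsupp.single_add] <;> congr 1
  · rw [show (q : ℂ) ^ (-n) = q * (q : ℂ) ^ (-(n + 1)) by
      rw [← zpow_one_add₀ hq]; congr 1; ring]
    ring
  · rw [show (q : ℂ) ^ (-n) = q * (q : ℂ) ^ (-(n + 1)) by
      rw [← zpow_one_add₀ hq]; congr 1; ring]
    ring
  · rw [show (q : ℂ) ^ (-(n - 1)) = q * (q : ℂ) ^ (-n) by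
      rw [← zpow_one_add₀ hq]; congr 1; ring]
    ring
  · ring
  · rw [show (q : ℂ) ^ (-(n - 1)) = q * (q : ℂ) ^ (-n) by
      rw [← zpow_one_add₀ hq]; congr 1; ring]
    ring
  · have h1 : (q : ℂ) ^ (-(2 * (n - 1) + 1)) = q * ((q : ℂ) ^ (-n) * (q : ℂ) ^ (-n)) := by
      rw [← zpow_add₀ hq, ← zpow_one_add₀ hq]; congr 1; ring
    have h2 : (q : ℂ) ^ (1 - 2 * n) = q * ((q : ℂ) ^ (-n) * (q : ℂ) ^ (-n)) := by
      rw [← zpow_add₀ hq, ← zpow_one_add₀ hq]; congr 1; ring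
    rw [h1, h2]
    -- Exactly one of the two conditions holds, so the factor containing βγ occurs exactly once in
    -- the product.
    split_ifs <;> first | lia | ring
  · have h1 : (q : ℂ) ^ (-(2 * n + 1)) = (q : ℂ)⁻¹ * ((q : ℂ) ^ (-n) * (q : ℂ) ^ (-n)) := by
      rw [← zpow_add₀ hq, ← zpow_neg_one, ← zpow_add₀ hq]; congr 1; ring
    have h2 : (q : ℂ) ^ (1 - 2 * (n + 1)) = (q : ℂ)⁻¹ * ((q : ℂ) ^ (-n) * (q : ℂ) ^ (-n)) := by
      rw [← zpow_add₀ hq, ← zpow_neg_one, ← zpow_add₀ hq]; congr 1; ring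
    rw [h1, h2]
    split_ifs <;> first | lia | ring

lemma rep_T (i j : Fin 2) : rep q β γ (T q i j) = repOp q β γ i j := lift_T ..

lemma rep_a_pow (n : ℕ) (z : ℂ) :
    rep q β γ (T q 0 0 ^ n) (Finsupp.single 0 z) = Finsupp.single (n : ℤ) z := by
  induction n with
  | zero => simp
  | succ n ih =>
    rw [pow_succ', map_mul, Module.End.mul_apply, ih, rep_T, repOp_a, if_pos (Int.natCast_nonneg n),
      mul_one, Nat.cast_add_one]

lemma rep_d_pow (n : ℕ) (z : ℂ) :
    rep q β γ (T q 1 1 ^ n) (Finsupp.single 0 z) = Finsupp.single (-n : ℤ) z := by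
  induction n with
  | zero => simp
  | succ n ih =>
    rw [pow_succ', map_mul, Module.End.mul_apply, ih, rep_T, repOp_d, if_pos (by lia), mul_one,
      Nat.cast_add_one, neg_add']

lemma rep_bc (n : ℤ) (r t : ℕ) (z : ℂ) :
    rep q β γ (T q 0 1 ^ r * T q 1 0 ^ t) (Finsupp.single n z) =
      Finsupp.single n (((q : ℂ) ^ (-n)) ^ (r + t) * (β ^ r * γ ^ t) * z) := by
  have hc : ∀ z, rep q β γ (T q 1 0 ^ t) (Finsupp.single n z) =
      Finsupp.single n (((q : ℂ) ^ (-n)) ^ t * γ ^ t * z) := by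
    induction t with
    | zero => simp
    | succ t ih =>
      intro z
      rw [pow_succ', map_mul, Module.End.mul_apply, ih, rep_T, repOp_c]
      congr 1; ring
  have hb : ∀ z, rep q β γ (T q 0 1 ^ r) (Finsupp.single n z) =
      Finsupp.single n (((q : ℂ) ^ (-n)) ^ r * β ^ r * z) := by
    induction r with
    | zero => simp
    | succ r ih =>
      intro z
      rw [pow_succ', map_mul, Module.End.mul_apply, ih, rep_T, repOp_b]
      congr 1; ring
  rw [map_mul, Module.End.mul_apply, hc, hb]
  congr 1; ring

/-- The nontrivial factors of `repOp` sit on `a` below 0 and on `d` above 0, so a^n and d^n carry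
δ_0 to δ_n and δ_(-n) without any factor. The scalar k is independent of β and γ, which is what the
independence argument needs. -/
lemma rep_mon (n : ℤ) (r t : ℕ) : ∃ k : ℂ, k ≠ 0 ∧ ∀ β γ : ℂ,
    rep q β γ (mon q (n, r, t)) (Finsupp.single 0 1) =
      k • Finsupp.single n (β ^ r * γ ^ t) := by
  induction n using int_cases with
  | h₁ n =>
    refine ⟨1, one_ne_zero, fun β γ => ?_⟩
    rw [mon_natCast, map_mul, Module.End.mul_apply, rep_bc, ← one_smul ℂ (Finsupp.single _ _),
      one_smul, rep_a_pow]
    simp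
  | h₂ n =>
    refine ⟨((q : ℂ) ^ (-(-((n + 1 : ℕ) : ℤ)))) ^ (r + t), ?_, fun β γ => ?_⟩
    · exact pow_ne_zero _ (zpow_ne_zero _ q.ne_zero)
    · rw [mon_neg_natCast, map_mul, Module.End.mul_apply, rep_d_pow, rep_bc, Finsupp.smul_single,
        mul_one, smul_eq_mul]

end representation

/-- The characters `(s, β, γ) ↦ s^n β^r γ^t`. -/
def character (i : ℤ × ℕ × ℕ) : ℂˣ × ℝ≥0 × ℝ≥0 →* ℂ where
  toFun g := (g.1 : ℂ) ^ i.1 * (((g.2.1 : ℝ) : ℂ) ^ i.2.1 * ((g.2.2 : ℝ) : ℂ) ^ i.2.2)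
  map_one' := by simp
  map_mul' g h := by
    simp only [Prod.fst_mul, Prod.snd_mul, Units.val_mul, NNReal.coe_mul, Complex.ofReal_mul,
      mul_pow, mul_zpow]
    ring

lemma character_injective : Function.Injective character := by
  rintro ⟨n, r, t⟩ ⟨n', r', t'⟩ h
  have h1 := DFunLike.congr_fun h (Units.mk0 2 two_ne_zero, 1, 1)
  have h2 := DFunLike.congr_fun h (1, 2, 1)
  have h3 := DFunLike.congr_fun h (1, 1, 2)
  simp only [character, MonoidHom.coe_mk, OneHom.coe_mk, Units.val_mk0, Units.val_one,
    NNReal.coe_one, Complex.ofReal_one, one_pow, mul_one, one_mul, one_zpow, NNReal.coe_ofNat,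
    Complex.ofReal_ofNat] at h1 h2 h3
  have e1 : n = n' := by
    have : (2 : ℝ) ^ n = (2 : ℝ) ^ n' :=
      Complex.ofReal_injective (by push_cast; exact h1)
    exact zpow_right_injective₀ two_pos (by norm_num) this
  have e2 : r = r' := Nat.pow_right_injective le_rfl (by exact_mod_cast h2)
  have e3 : t = t' := Nat.pow_right_injective le_rfl (by exact_mod_cast h3)
  rw [e1, e2, e3]

lemma linearIndependent_character :
    LinearIndependent ℂ fun i => (character i : ℂˣ × ℝ≥0 × ℝ≥0 → ℂ) :=
  (linearIndependent_monoidHom (ℂˣ × ℝ≥0 × ℝ≥0) ℂ).comp character character_injective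

lemma linearIndependent_mon (q : ℂˣ) : LinearIndependent ℂ (mon q) := by
  choose k hk hrep using fun i : ℤ × ℕ × ℕ => rep_mon q i.1 i.2.1 i.2.2
  -- Apply the representation to δ_0 and replace δ_n by s^n: each monomial becomes a nonzero
  -- multiple of its character.
  let F : SLq q →ₗ[ℂ] (ℂˣ × ℝ≥0 × ℝ≥0 → ℂ) := LinearMap.pi fun g =>
    Finsupp.linearCombination ℂ (fun n : ℤ => (g.1 : ℂ) ^ n) ∘ₗ
      LinearMap.applyₗ (Finsupp.single (0 : ℤ) (1 : ℂ)) ∘ₗ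
        (rep q (g.2.1 : ℝ) (g.2.2 : ℝ)).toLinearMap
  refine LinearIndependent.of_comp F ?_
  have h := linearIndependent_character.units_smul fun i => Units.mk0 (k i) (hk i)
  convert h using 1
  funext i g
  simp only [F, Function.comp_apply, LinearMap.pi_apply, LinearMap.comp_apply,
    LinearMap.applyₗ_apply_apply, AlgHom.toLinearMap_apply]
  rw [hrep i, map_smul, Finsupp.linearCombination_single]
  simp [character, Units.smul_def, mul_comm]

/-- The Poincaré–Birkhoff–Witt basis of `A(SL_q(2))`. -/
def monBasis (q : ℂˣ) : Module.Basis (ℤ × ℕ × ℕ) ℂ (SLq q) :=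
  .mk (linearIndependent_mon q) (span_mon q)

lemma monBasis_apply (q : ℂˣ) (i : ℤ × ℕ × ℕ) : monBasis q i = mon q i := by
  simp [monBasis]

/-! ### The cubes of the generators -/

lemma commute_cube_of_skew {R : Type*} [Ring R] [Algebra ℂ R] {x y : R} {k : ℂ}
    (h : x * y = k • (y * x)) (hk : k ^ 3 = 1) : Commute (x ^ 3) y := by
  rw [commute_iff_eq, pow_mul_of_skew h, hk, one_smul]

/-- Both sides equal x² plus a multiple of x²z: the multiple is k on the left, and l · l⁴ on the
right, after z has crossed x². -/
lemma commute_cube_of_det {R : Type*} [Ring R] [Algebra ℂ R] {x y z : R} {k l : ℂ}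
    (h : x * y = 1 + k • z) (h' : y * x = 1 + l • z) (hz : z * x = l ^ 2 • (x * z))
    (hkl : k = l ^ 5) : Commute (x ^ 3) y := by
  have h2 : z * x ^ 2 = l ^ 4 • (x ^ 2 * z) := by
    rw [mul_pow_of_skew hz, ← pow_mul]
  calc x ^ 3 * y = x ^ 2 * (x * y) := by noncomm_ring
    _ = x ^ 2 + k • (x ^ 2 * z) := by rw [h, mul_add, mul_one, mul_smul_comm]
    _ = (y * x) * x ^ 2 := by
      rw [h', add_mul, one_mul, smul_mul_assoc, h2, smul_smul, hkl]; ring_nf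
    _ = y * x ^ 3 := by noncomm_ring

lemma zeta_cube : (zeta : ℂ) ^ 3 = 1 := zeta_primitive.pow_eq_one

lemma zeta_inv_cube : (zeta : ℂ)⁻¹ ^ 3 = 1 := by rw [inv_pow, zeta_cube, inv_one]

lemma zeta_add : 1 + (zeta : ℂ) + (zeta : ℂ) ^ 2 = 0 := by
  have h := zeta_primitive.geom_sum_eq_zero (by norm_num)
  simpa [Finset.sum_range_succ] using h

lemma zeta_inv : (zeta : ℂ)⁻¹ = (zeta : ℂ) ^ 2 :=
  inv_eq_of_mul_eq_one_right (by rw [← pow_succ', zeta_cube])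

/-- Generators other than the pair a, d commute up to a power of q, whose cube is 1. For a and d the
determinant relations are used, with q = q⁻⁵ or q⁻¹ = q⁵. -/
lemma cube_mem_center (i j : Fin 2) : T zeta i j ^ 3 ∈ Subalgebra.center ℂ P := by
  rw [Subalgebra.mem_center_iff]
  have hq := zeta_cube
  have hq' := zeta_inv_cube
  have hz : T zeta 0 1 * T zeta 1 0 * T zeta 0 0 =
      ((zeta : ℂ)⁻¹) ^ 2 • (T zeta 0 0 * (T zeta 0 1 * T zeta 1 0)) := by
    rw [mul_assoc, T_ca, mul_smul_comm, ← mul_assoc, T_ba, smul_mul_assoc, smul_smul, sq, mul_assoc]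
  have hz' : T zeta 0 1 * T zeta 1 0 * T zeta 1 1 =
      (zeta : ℂ) ^ 2 • (T zeta 1 1 * (T zeta 0 1 * T zeta 1 0)) := by
    rw [mul_assoc, T_cd, mul_smul_comm, ← mul_assoc, T_bd, smul_mul_assoc, smul_smul, sq, mul_assoc]
  have hgen : ∀ k l, Commute (T zeta i j ^ 3) (T zeta k l) := by
    intro k l
    fin_cases i <;> fin_cases j <;> fin_cases k <;> fin_cases l
    · exact (Commute.refl _).pow_left 3
    · exact commute_cube_of_skew (T_ab _) hq
    · exact commute_cube_of_skew (T_ac _) hq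
    · refine commute_cube_of_det (T_ad _) (T_da _) hz ?_
      rw [zeta_inv]; linear_combination (-(zeta : ℂ) ^ 7 - zeta ^ 4 - zeta) * hq
    · exact commute_cube_of_skew (T_ba _) hq'
    · exact (Commute.refl _).pow_left 3
    · exact (commute_bc zeta).pow_left 3
    · exact commute_cube_of_skew (T_bd _) hq
    · exact commute_cube_of_skew (T_ca _) hq'
    · exact (commute_bc zeta).symm.pow_left 3
    · exact (Commute.refl _).pow_left 3
    · exact commute_cube_of_skew (T_cd _) hq
    · refine commute_cube_of_det (T_da _) (T_ad _) hz' ?_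
      rw [zeta_inv]; linear_combination -(zeta : ℂ) ^ 2 * hq
    · exact commute_cube_of_skew (T_db _) hq'
    · exact commute_cube_of_skew (T_dc _) hq'
    · exact (Commute.refl _).pow_left 3
  intro y
  induction y using induction with
  | hs r => exact Algebra.commutes ..
  | hT k l => exact (hgen k l).eq.symm
  | hm x y hx hy => rw [mul_assoc, hy, ← mul_assoc, hx, mul_assoc]
  | ha x y hx hy => rw [add_mul, mul_add, hx, hy]

lemma cube_comm (i j : Fin 2) (x : P) : T zeta i j ^ 3 * x = x * T zeta i j ^ 3 :=
  (Subalgebra.mem_center_iff.1 (cube_mem_center i j) x).symm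

/-- With z = bc and az = q² za, one gets a³d³ = (1 + q⁵z)(1 + q³z)(1 + qz). The coefficients q⁵, q³,
q run through the three cube roots of unity, so the product is 1 + z³. -/
lemma cube_det : T zeta 0 0 ^ 3 * T zeta 1 1 ^ 3 = 1 + T zeta 0 1 ^ 3 * T zeta 1 0 ^ 3 := by
  set a := T zeta 0 0
  set d := T zeta 1 1
  set z := T zeta 0 1 * T zeta 1 0 with hz
  have hq := zeta_cube
  have had : a * d = 1 + (zeta : ℂ) • z := T_ad zeta
  have haz : a * z = (zeta : ℂ) ^ 2 • (z * a) := by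
    rw [hz, ← mul_assoc, T_ab, smul_mul_assoc, mul_assoc, T_ac, mul_smul_comm, smul_smul, sq,
      mul_assoc]
  have hstep : ∀ k : ℂ, a * (1 + k • z) * d = (1 + (zeta ^ 2 * k) • z) * (1 + (zeta : ℂ) • z) := by
    intro k
    rw [← had, mul_add, mul_smul_comm, haz, smul_smul, mul_one, ← mul_assoc, add_mul _ _ a, one_mul,
      smul_mul_assoc, mul_comm k]
  have hcomm : ∀ k l : ℂ, (1 + k • z) * (1 + l • z) = 1 + (k + l) • z + (k * l) • (z * z) := by
    intro k l
    simp only [mul_add, add_mul, mul_one, one_mul, smul_mul_assoc, mul_smul_comm]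
    module
  have ha2 : a * (z * z) * d = (zeta : ℂ) ^ 4 • (z * z * (1 + (zeta : ℂ) • z)) := by
    rw [← mul_assoc, haz, smul_mul_assoc, mul_assoc, haz, mul_smul_comm, smul_smul, smul_mul_assoc,
      ← had]
    simp only [mul_assoc]
    congr 1
    ring
  have hz3 : z * z * z = T zeta 0 1 ^ 3 * T zeta 1 0 ^ 3 := by
    rw [← (commute_bc zeta).mul_pow 3, ← hz]; noncomm_ring
  have h2 : a ^ 2 * d ^ 2 = 1 + (zeta + 1 : ℂ) • z + (zeta : ℂ) • (z * z) := by
    rw [sq, sq, mul_assoc, ← mul_assoc a d d, had, ← mul_assoc, hstep, hcomm]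
    congr 2
    · congr 1; linear_combination hq
    · linear_combination (zeta : ℂ) * hq
  calc a ^ 3 * d ^ 3 = a * (a ^ 2 * d ^ 2) * d := by noncomm_ring
    _ = a * (1 + (zeta + 1 : ℂ) • z) * d + (zeta : ℂ) • (a * (z * z) * d) := by
      rw [h2, mul_add a, mul_smul_comm, add_mul _ _ d, smul_mul_assoc]
    _ = 1 + z * z * z := by
      rw [hstep, hcomm, ha2, mul_add (z * z), mul_one, mul_smul_comm]
      match_scalars
      · ring
      · linear_combination zeta_add + hq
      · linear_combination (zeta : ℂ) ^ 3 * zeta_add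
      · linear_combination ((zeta : ℂ) ^ 3 + 1) * hq
    _ = _ := by rw [hz3]

/-! ### The Frobenius map -/

/-- The classical counterpart of the Frobenius map, `T_ij ↦ T_ij³`, on `A(SL_q(2))` at `q = 1`. -/
def cubeHom : SLq 1 →ₐ[ℂ] P :=
  lift 1 (fun i j => T zeta i j ^ 3)
    (by simpa using cube_comm _ _ _) (by simpa using cube_comm _ _ _)
    (by simpa using cube_comm _ _ _) (by simpa using cube_comm _ _ _)
    (by simpa using cube_comm _ _ _) (by simpa using cube_det)
    (by rw [cube_comm]; simpa using cube_det)

lemma cubeHom_T (i j : Fin 2) : cubeHom (T 1 i j) = T zeta i j ^ 3 := lift_T ..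

/-- Multiplication of all exponents by `3`. -/
def triple (i : ℤ × ℕ × ℕ) : ℤ × ℕ × ℕ := (3 * i.1, 3 * i.2.1, 3 * i.2.2)

lemma triple_injective : Function.Injective triple := by
  rintro ⟨n, r, t⟩ ⟨n', r', t'⟩ h
  simp only [triple, Prod.mk.injEq] at h ⊢
  lia

lemma cubeHom_mon (i : ℤ × ℕ × ℕ) : cubeHom (mon 1 i) = mon zeta (triple i) := by
  have h1 : (3 * i.1).toNat = 3 * i.1.toNat := by lia
  have h2 : (-(3 * i.1)).toNat = 3 * (-i.1).toNat := by lia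
  simp only [mon, map_mul, map_pow, cubeHom_T, ← pow_mul, triple, h1, h2]

lemma injective_of_linearIndependent_mon {q : ℂˣ} {V : Type*} [AddCommGroup V] [Module ℂ V]
    (f : SLq q →ₗ[ℂ] V) (h : LinearIndependent ℂ fun i => f (mon q i)) :
    Function.Injective f := by
  rw [← LinearMap.ker_eq_bot, LinearMap.ker_eq_bot']
  intro x hx
  have hsum := (monBasis q).linearCombination_repr x
  rw [← hsum, Finsupp.apply_linearCombination] at hx
  have hf : f ∘ monBasis q = fun i => f (mon q i) := funext fun i => by
    rw [Function.comp_apply, monBasis_apply]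
  rw [hf] at hx
  simpa using linearIndependent_iff.1 h _ hx

lemma cubeHom_injective : Function.Injective cubeHom := by
  refine injective_of_linearIndependent_mon cubeHom.toLinearMap ?_
  simp only [AlgHom.toLinearMap_apply, cubeHom_mon]
  exact (linearIndependent_mon zeta).comp _ triple_injective

/-! ### The algebra at q = 1 and polynomial functions on SL(2, ℂ) -/

lemma Tbar_det : Tbar 0 0 * Tbar 1 1 = 1 + Tbar 0 1 * Tbar 1 0 := by
  refine Subtype.ext (funext fun g => ?_)
  have h := g.2
  rw [Matrix.det_fin_two] at h
  exact sub_eq_iff_eq_add.1 h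

/-- The comparison of `A(SL_q(2))` at `q = 1` with the polynomial functions on `SL(2, ℂ)`. -/
def classicalHom : SLq 1 →ₐ[ℂ] polyFun :=
  lift 1 Tbar (by simp [mul_comm]) (by simp [mul_comm]) (by simp [mul_comm]) (by simp [mul_comm])
    (by simp [mul_comm]) (by simpa using Tbar_det) (by rw [mul_comm]; simpa using Tbar_det)

lemma classicalHom_T (i j : Fin 2) : classicalHom (T 1 i j) = Tbar i j := lift_T ..

lemma classicalHom_surjective : Function.Surjective classicalHom := by
  have h : polyFun ≤ (polyFun.val.comp classicalHom).range := by
    refine Algebra.adjoin_le ?_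
    rintro _ ⟨p, rfl⟩
    exact ⟨T 1 p.1 p.2, by simp [classicalHom_T, Tbar]⟩
  intro f
  obtain ⟨x, hx⟩ := h f.2
  exact ⟨x, Subtype.ext hx⟩

/-- The matrix `(s, β; γ, (1 + βγ)/s)`. -/
def point (g : ℂˣ × ℝ≥0 × ℝ≥0) : Matrix.SpecialLinearGroup (Fin 2) ℂ :=
  ⟨!![(g.1 : ℂ), (g.2.1 : ℝ); (g.2.2 : ℝ), (g.1 : ℂ)⁻¹ * (1 + (g.2.1 : ℝ) * (g.2.2 : ℝ))], by
    rw [Matrix.det_fin_two_of, ← mul_assoc, mul_inv_cancel₀ g.1.ne_zero]; ring⟩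

lemma coeff_point (i j : Fin 2) (g : ℂˣ × ℝ≥0 × ℝ≥0) : coeff i j (point g) =
    !![(g.1 : ℂ), (g.2.1 : ℝ); (g.2.2 : ℝ),
      (g.1 : ℂ)⁻¹ * (1 + (g.2.1 : ℝ) * (g.2.2 : ℝ))] i j := rfl

lemma classicalHom_mon_point (i : ℤ × ℕ × ℕ) (g : ℂˣ × ℝ≥0 × ℝ≥0) :
    (classicalHom (mon 1 i) : Matrix.SpecialLinearGroup (Fin 2) ℂ → ℂ) (point g) =
      character i g * (1 + (g.2.1 : ℝ) * (g.2.2 : ℝ)) ^ (-i.1).toNat := by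
  have hs : (g.1 : ℂ) ^ i.1 = (g.1 : ℂ) ^ i.1.toNat * (g.1 : ℂ)⁻¹ ^ (-i.1).toNat := by
    rw [← zpow_natCast, ← zpow_natCast, inv_zpow', ← zpow_add₀ g.1.ne_zero]
    congr 1; lia
  simp only [mon, map_mul, map_pow, classicalHom_T, Tbar, character, MulMemClass.coe_mul,
    SubmonoidClass.coe_pow, Pi.mul_apply, Pi.pow_apply, coeff_point, MonoidHom.coe_mk,
    OneHom.coe_mk, hs]
  simp only [Matrix.of_apply, Matrix.cons_val', Matrix.cons_val_zero, Matrix.cons_val_one,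
    Matrix.cons_val_fin_one, mul_pow]
  ring

lemma linearIndependent_zpow :
    LinearIndependent ℂ fun (n : ℤ) (s : ℂˣ) => (s : ℂ) ^ n := by
  have h := linearIndependent_character.comp (fun n : ℤ => (n, 0, 0)) fun m n h => by simpa using h
  refine LinearIndependent.of_comp
    (LinearMap.funLeft ℂ ℂ (fun g : ℂˣ × ℝ≥0 × ℝ≥0 => g.1)) ?_
  convert h using 1
  funext n g
  simp [LinearMap.funLeft_apply, character]

/-- At `point` a monomial takes the value s^n β^r γ^t u^(max(-n, 0)) with u = 1 + βγ, which is not a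
character. Independence of the functions s^n separates the values of n for fixed β and γ; then the
power of u can be divided out for each n, and independence of the characters applies. -/
lemma linearIndependent_classicalHom_mon :
    LinearIndependent ℂ fun i => classicalHom (mon 1 i) := by
  rw [linearIndependent_iff]
  intro l hl
  refine linearIndependent_iff.1 linearIndependent_character l ?_
  funext ⟨s, β, γ⟩
  set u : ℂ := 1 + (β : ℝ) * (γ : ℝ) with hu_def
  -- This is why β and γ range over nonnegative reals.
  have hu : u ≠ 0 := by
    have : (0 : ℝ) < 1 + β * γ := by positivity
    rw [hu_def]; exact_mod_cast this.ne'
  let w : ℤ × ℕ × ℕ → ℂ := fun i =>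
    ((β : ℝ) : ℂ) ^ i.2.1 * ((γ : ℝ) : ℂ) ^ i.2.2 * u ^ (-i.1).toNat
  -- `D` collects, for fixed β and γ, the coefficient of each power of s.
  let D : ℤ →₀ ℂ := Finsupp.linearCombination ℂ (fun i => Finsupp.single i.1 (w i)) l
  have hD : D = 0 := by
    refine linearIndependent_iff.1 linearIndependent_zpow D ?_
    funext s'
    have h := congrFun (congrArg Subtype.val hl) (point (s', β, γ))
    rw [Finsupp.linearCombination_apply, Finsupp.sum, AddSubmonoidClass.coe_finsetSum,
      Finset.sum_apply] at h
    simp only [D]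
    rw [Finsupp.apply_linearCombination, Finsupp.linearCombination_apply, Finsupp.sum,
      Finset.sum_apply]
    refine Eq.trans (Finset.sum_congr rfl fun i _ => ?_) h
    change l i * _ = l i * _
    rw [classicalHom_mon_point, Function.comp_apply, Finsupp.linearCombination_single]
    simp only [w, character, MonoidHom.coe_mk, OneHom.coe_mk, smul_eq_mul, Pi.smul_apply, hu_def]
    ring
  -- Recombine the vanishing coefficients with weights s^n divided by the power of u.
  have h := congrArg (Finsupp.linearCombination ℂ
    fun n : ℤ => (s : ℂ) ^ n * (u ^ (-n).toNat)⁻¹) hD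
  simp only [D] at h
  rw [map_zero, Finsupp.apply_linearCombination, Finsupp.linearCombination_apply, Finsupp.sum] at h
  rw [Finsupp.linearCombination_apply, Finsupp.sum, Finset.sum_apply]
  refine Eq.trans (Finset.sum_congr rfl fun i _ => ?_) h
  change l i * _ = l i * _
  rw [Function.comp_apply, Finsupp.linearCombination_single]
  have := pow_ne_zero (-i.1).toNat hu
  simp only [w, character, MonoidHom.coe_mk, OneHom.coe_mk]
  rw [smul_eq_mul]
  field_simp

/-- `A(SL_q(2))` at `q = 1` is the algebra of polynomial functions on `SL(2, ℂ)`. -/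
def classicalEquiv : SLq 1 ≃ₐ[ℂ] polyFun :=
  AlgEquiv.ofBijective classicalHom
    ⟨injective_of_linearIndependent_mon classicalHom.toLinearMap linearIndependent_classicalHom_mon,
      classicalHom_surjective⟩

/-- The Frobenius map. -/
def frobenius : polyFun →ₐ[ℂ] P := cubeHom.comp classicalEquiv.symm

lemma frobenius_classicalHom (x : SLq 1) : frobenius (classicalHom x) = cubeHom x :=
  congrArg cubeHom (classicalEquiv.symm_apply_apply x)

lemma isFrobenius_frobenius : IsFrobenius frobenius := fun i j => by
  rw [← classicalHom_T, frobenius_classicalHom, cubeHom_T]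

lemma IsFrobenius.eq_frobenius {Fr : polyFun →ₐ[ℂ] P} (h : IsFrobenius Fr) : Fr = frobenius := by
  have hc : Fr.comp classicalHom = frobenius.comp classicalHom := algHom_ext fun i j => by
    rw [AlgHom.comp_apply, AlgHom.comp_apply, classicalHom_T, h, isFrobenius_frobenius]
  ext1 f
  obtain ⟨x, rfl⟩ := classicalHom_surjective f
  exact DFunLike.congr_fun hc x

lemma frobenius_injective : Function.Injective frobenius :=
  cubeHom_injective.comp classicalEquiv.symm.injective

lemma mem_range_frobenius {x : P} : x ∈ frobenius.range ↔ ∃ y, cubeHom y = x := by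
  constructor
  · rintro ⟨f, rfl⟩
    exact ⟨classicalEquiv.symm f, rfl⟩
  · rintro ⟨y, rfl⟩
    exact ⟨classicalHom y, frobenius_classicalHom y⟩

/-! ### The splitting -/

/-- All exponents are divisible by `3`. -/
abbrev Triple (i : ℤ × ℕ × ℕ) : Prop := 3 ∣ i.1 ∧ 3 ∣ i.2.1 ∧ 3 ∣ i.2.2

lemma Triple.exists_eq {i : ℤ × ℕ × ℕ} (h : Triple i) : ∃ j, triple j = i := by
  obtain ⟨n, r, t⟩ := i
  obtain ⟨⟨n, rfl⟩, ⟨r, rfl⟩, ⟨t, rfl⟩⟩ := h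
  exact ⟨(n, r, t), rfl⟩

lemma Triple.mon_mem {i : ℤ × ℕ × ℕ} (h : Triple i) : mon zeta i ∈ frobenius.range := by
  obtain ⟨j, rfl⟩ := h.exists_eq
  exact mem_range_frobenius.2 ⟨_, cubeHom_mon j⟩

/-- The splitting of the inclusion of the image of the Frobenius map. -/
def splitting : P →ₗ[ℂ] frobenius.range :=
  (monBasis zeta).constr ℂ fun i => if h : Triple i then ⟨mon zeta i, h.mon_mem⟩ else 0

lemma splitting_mon (i : ℤ × ℕ × ℕ) :
    (splitting (mon zeta i) : P) = if Triple i then mon zeta i else 0 := by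
  rw [← monBasis_apply, splitting, Module.Basis.constr_basis, monBasis_apply]
  split_ifs <;> rfl

lemma mon_abc (p r t : ℕ) :
    T zeta 0 0 ^ p * T zeta 0 1 ^ r * T zeta 1 0 ^ t = mon zeta (p, r, t) := by
  rw [mon_natCast, mul_assoc]

lemma isSplitting_splitting : IsSplitting frobenius.range splitting where
  abc p r t := by
    have : Triple ((p : ℤ), r, t) ↔ 3 ∣ p ∧ 3 ∣ r ∧ 3 ∣ t := by
      simp only [Triple]; lia
    simp only [mon_abc, splitting_mon, this]
  bcd k l m _ := by
    have : Triple (-(m : ℤ), k, l) ↔ 3 ∣ k ∧ 3 ∣ l ∧ 3 ∣ m := by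
      simp only [Triple]; lia
    simp only [← mon_neg_natCast, splitting_mon, this]

lemma IsSplitting.eq {B : Subalgebra ℂ P} {s s' : P →ₗ[ℂ] B} (h : IsSplitting B s)
    (h' : IsSplitting B s') : s = s' := by
  refine (monBasis zeta).ext fun ⟨n, r, t⟩ => Subtype.ext ?_
  rw [monBasis_apply]
  induction n using int_cases with
  | h₁ n => rw [← mon_abc, h.abc, h'.abc]
  | h₂ n => rw [mon_neg_natCast, h.bcd _ _ _ n.succ_pos, h'.bcd _ _ _ n.succ_pos]

lemma splitting_cubeHom (y : SLq 1) : (splitting (cubeHom y) : P) = cubeHom y := by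
  have : frobenius.range.val.toLinearMap ∘ₗ splitting ∘ₗ cubeHom.toLinearMap =
      cubeHom.toLinearMap := by
    refine (monBasis 1).ext fun i => ?_
    have h : Triple (triple i) := ⟨⟨_, rfl⟩, ⟨_, rfl⟩, ⟨_, rfl⟩⟩
    simp [monBasis_apply, cubeHom_mon, splitting_mon, h]
  exact LinearMap.congr_fun this y

lemma splitting_one : splitting 1 = 1 :=
  Subtype.ext <| by simpa using splitting_cubeHom 1

lemma splitting_mon_eq_zero {i : ℤ × ℕ × ℕ} (h : ¬ Triple i) : splitting (mon zeta i) = 0 :=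
  Subtype.ext <| by rw [splitting_mon, if_neg h]; rfl

lemma splitting_eq_zero_of_mem_layer {n : ℤ} (hn : ¬ 3 ∣ n) {x : P} (hx : x ∈ layer zeta n) :
    splitting x = 0 := by
  have : layer zeta n ≤ LinearMap.ker splitting := by
    rw [layer, Submodule.span_le]
    rintro _ ⟨p, rfl⟩
    exact splitting_mon_eq_zero fun h => hn h.1
  exact this hx

/-! ### Linearity of the splitting over the image of the Frobenius map -/

lemma cube_b_mul_mon {i : ℤ × ℕ × ℕ} (h : ¬ Triple i) :
    ∃ (k : ℂ) (j : ℤ × ℕ × ℕ), ¬ Triple j ∧ T zeta 0 1 ^ 3 * mon zeta i = k • mon zeta j := by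
  obtain ⟨n, r, t⟩ := i
  obtain ⟨k, -, -, h1⟩ := b_mul_mon zeta n r t
  obtain ⟨k', -, -, h2⟩ := b_mul_mon zeta n (r + 1) t
  obtain ⟨k'', -, -, h3⟩ := b_mul_mon zeta n (r + 2) t
  refine ⟨k * k' * k'', (n, r + 3, t), fun h' => h ?_, ?_⟩
  · simp only [Triple] at h' ⊢; lia
  · rw [pow_succ, sq, mul_assoc, mul_assoc, h1, mul_smul_comm, h2, mul_smul_comm, mul_smul_comm, h3]
    simp only [smul_smul, mul_assoc]

lemma cube_c_mul_mon {i : ℤ × ℕ × ℕ} (h : ¬ Triple i) :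
    ∃ (k : ℂ) (j : ℤ × ℕ × ℕ), ¬ Triple j ∧ T zeta 1 0 ^ 3 * mon zeta i = k • mon zeta j := by
  obtain ⟨n, r, t⟩ := i
  obtain ⟨k, -, -, h1⟩ := c_mul_mon zeta n r t
  obtain ⟨k', -, -, h2⟩ := c_mul_mon zeta n r (t + 1)
  obtain ⟨k'', -, -, h3⟩ := c_mul_mon zeta n r (t + 2)
  refine ⟨k * k' * k'', (n, r, t + 3), fun h' => h ?_, ?_⟩
  · simp only [Triple] at h' ⊢; lia
  · rw [pow_succ, sq, mul_assoc, mul_assoc, h1, mul_smul_comm, h2, mul_smul_comm, mul_smul_comm, h3]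
    simp only [smul_smul, mul_assoc]

lemma splitting_det_mul {i : ℤ × ℕ × ℕ} (h : ¬ Triple i) :
    splitting (T zeta 0 0 ^ 3 * T zeta 1 1 ^ 3 * mon zeta i) = 0 := by
  obtain ⟨k, j, hj, h1⟩ := cube_c_mul_mon h
  obtain ⟨k', j', hj', h2⟩ := cube_b_mul_mon hj
  rw [cube_det, add_mul, one_mul, mul_assoc, h1, mul_smul_comm, h2, map_add, map_smul, map_smul,
    splitting_mon_eq_zero h, splitting_mon_eq_zero hj', smul_zero, smul_zero, add_zero]

/-- If 3 does not divide n, the degree settles it. If it does and n ≥ 0, the exponent of `a` grows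
by 3. If n < 0 then n ≤ -3, so a factor d³ can be split off, and a³d³ = 1 + b³c³ leaves only shifts
by 3 in r and t. -/
lemma splitting_cube_a_mul_mon {i : ℤ × ℕ × ℕ} (h : ¬ Triple i) :
    splitting (T zeta 0 0 ^ 3 * mon zeta i) = 0 := by
  obtain ⟨n, r, t⟩ := i
  by_cases hn : 3 ∣ n
  · obtain hn0 | hn0 := le_or_gt 0 n
    · rw [pow_succ, sq, mul_assoc, mul_assoc, a_mul_mon_of_nonneg _ hn0,
        a_mul_mon_of_nonneg _ (by lia), a_mul_mon_of_nonneg _ (by lia)]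
      refine splitting_mon_eq_zero fun h' => h ?_
      simp only [Triple] at h' ⊢; lia
    · obtain ⟨m, rfl⟩ : ∃ m : ℕ, n = -(m + 3 : ℕ) := ⟨(-n - 3).toNat, by lia⟩
      have hm : mon zeta (-(m + 3 : ℕ), r, t) = T zeta 1 1 ^ 3 * mon zeta (-m, r, t) := by
        rw [mon_neg_natCast, mon_neg_natCast, cube_comm, pow_add, ← mul_assoc]
      rw [hm, ← mul_assoc]
      refine splitting_det_mul fun h' => h ?_
      simp only [Triple] at h' ⊢; lia
  · rw [pow_succ, sq, mul_assoc, mul_assoc]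
    exact splitting_eq_zero_of_mem_layer (by lia)
      (a_mul_mem_layer _ (a_mul_mem_layer _ (a_mul_mem_layer _ (mon_mem_layer zeta n r t))))

lemma splitting_cube_d_mul_mon {i : ℤ × ℕ × ℕ} (h : ¬ Triple i) :
    splitting (T zeta 1 1 ^ 3 * mon zeta i) = 0 := by
  obtain ⟨n, r, t⟩ := i
  by_cases hn : 3 ∣ n
  · obtain hn0 | hn0 := le_or_gt n 0
    · rw [pow_succ, sq, mul_assoc, mul_assoc, d_mul_mon_of_nonpos _ hn0, mul_smul_comm,
        d_mul_mon_of_nonpos _ (by lia), mul_smul_comm, mul_smul_comm,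
        d_mul_mon_of_nonpos _ (by lia), map_smul, map_smul, map_smul, splitting_mon_eq_zero,
        smul_zero, smul_zero, smul_zero]
      refine fun h' => h ?_
      simp only [Triple] at h' ⊢; lia
    · obtain ⟨m, rfl⟩ : ∃ m : ℕ, n = (m + 3 : ℕ) := ⟨(n - 3).toNat, by lia⟩
      have hm : mon zeta ((m + 3 : ℕ), r, t) = T zeta 0 0 ^ 3 * mon zeta (m, r, t) := by
        rw [mon_natCast, mon_natCast, add_comm, pow_add, mul_assoc]
      rw [hm, ← mul_assoc, cube_comm]
      refine splitting_det_mul fun h' => h ?_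
      simp only [Triple] at h' ⊢; lia
  · rw [pow_succ, sq, mul_assoc, mul_assoc]
    exact splitting_eq_zero_of_mem_layer (by lia)
      (d_mul_mem_layer _ (d_mul_mem_layer _ (d_mul_mem_layer _ (mon_mem_layer zeta n r t))))

lemma splitting_cube_mul_eq_zero (k l : Fin 2) {i : ℤ × ℕ × ℕ} (h : ¬ Triple i) :
    splitting (T zeta k l ^ 3 * mon zeta i) = 0 := by
  fin_cases k <;> fin_cases l
  · exact splitting_cube_a_mul_mon h
  · obtain ⟨k, j, hj, h1⟩ := cube_b_mul_mon h
    exact (congrArg splitting h1).trans <| by rw [map_smul, splitting_mon_eq_zero hj, smul_zero]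
  · obtain ⟨k, j, hj, h1⟩ := cube_c_mul_mon h
    exact (congrArg splitting h1).trans <| by rw [map_smul, splitting_mon_eq_zero hj, smul_zero]
  · exact splitting_cube_d_mul_mon h

/-- On a monomial with exponents divisible by 3 both factors lie in the image, where the splitting
is the identity; on any other monomial both sides vanish. -/
lemma splitting_cube_mul (k l : Fin 2) (x : P) :
    (splitting (T zeta k l ^ 3 * x) : P) = T zeta k l ^ 3 * splitting x := by
  have : frobenius.range.val.toLinearMap ∘ₗ splitting ∘ₗ LinearMap.mulLeft ℂ (T zeta k l ^ 3) =
      LinearMap.mulLeft ℂ (T zeta k l ^ 3) ∘ₗ frobenius.range.val.toLinearMap ∘ₗ splitting := by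
    refine (monBasis zeta).ext fun i => ?_
    simp only [LinearMap.comp_apply, LinearMap.mulLeft_apply, AlgHom.toLinearMap_apply,
      Subalgebra.val_apply, monBasis_apply]
    by_cases h : Triple i
    · obtain ⟨j, rfl⟩ := h.exists_eq
      rw [← cubeHom_mon, splitting_cubeHom, ← cubeHom_T, ← map_mul, splitting_cubeHom]
    · rw [splitting_cube_mul_eq_zero k l h, splitting_mon_eq_zero h, ZeroMemClass.coe_zero,
        mul_zero]
  exact LinearMap.congr_fun this x

lemma splitting_cubeHom_mul (y : SLq 1) :
    ∀ x : P, (splitting (cubeHom y * x) : P) = cubeHom y * splitting x := by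
  induction y using induction with
  | hs r => intro x; simp [← Algebra.smul_def]
  | hT i j => intro x; rw [cubeHom_T, splitting_cube_mul]
  | hm y z hy hz => intro x; rw [map_mul cubeHom, mul_assoc, hy, hz, mul_assoc]
  | ha y z hy hz => intro x; simp [add_mul, hy, hz]

lemma splitting_mul (f : frobenius.range) (x : P) : splitting ((f : P) * x) = f * splitting x := by
  obtain ⟨y, hy⟩ := mem_range_frobenius.1 f.2
  exact Subtype.ext <| by rw [← hy, splitting_cubeHom_mul, MulMemClass.coe_mul, hy]

lemma range_frobenius_le_center : frobenius.range ≤ Subalgebra.center ℂ P := by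
  intro x hx
  obtain ⟨y, rfl⟩ := mem_range_frobenius.1 hx
  induction y using induction with
  | hs r => rw [AlgHom.commutes]; exact Subalgebra.algebraMap_mem _ r
  | hT i j => rw [cubeHom_T]; exact cube_mem_center i j
  | hm y z hy hz =>
    rw [map_mul]
    exact mul_mem (hy (mem_range_frobenius.2 ⟨_, rfl⟩)) (hz (mem_range_frobenius.2 ⟨_, rfl⟩))
  | ha y z hy hz =>
    rw [map_add]
    exact add_mem (hy (mem_range_frobenius.2 ⟨_, rfl⟩)) (hz (mem_range_frobenius.2 ⟨_, rfl⟩))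

lemma mul_splitting (f : frobenius.range) (x : P) : splitting (x * (f : P)) = splitting x * f := by
  have hf := Subalgebra.mem_center_iff.1 (range_frobenius_le_center f.2)
  rw [hf, splitting_mul]
  exact Subtype.ext (hf _).symm

lemma splitting_coe (f : frobenius.range) : splitting (f : P) = f := by
  obtain ⟨y, hy⟩ := mem_range_frobenius.1 f.2
  exact Subtype.ext <| by rw [← hy, splitting_cubeHom]

/-- The splitting as a module endomorphism. -/
def splittingEnd : P →ₗ[frobenius.range] P where
  toFun x := splitting x
  map_add' x y := by simp
  map_smul' f x := by
    change (splitting ((f : P) * x) : P) = f * splitting x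
    rw [splitting_mul, MulMemClass.coe_mul]

lemma isIdempotentElem_splittingEnd : IsIdempotentElem splittingEnd :=
  LinearMap.ext fun x => congrArg Subtype.val (splitting_coe (splitting x))

lemma exists_isCompl_splitting : ∃ M N : Submodule frobenius.range P,
    (M : Set P) = frobenius.range ∧ (N : Set P) = Set.range (fun x : P => x - (splitting x : P)) ∧
      IsCompl M N := by
  -- Range and kernel of an idempotent are complementary, and the kernel is the range of id - s.
  refine ⟨LinearMap.range splittingEnd, LinearMap.ker splittingEnd, ?_, ?_,
    LinearMap.IsIdempotentElem.isCompl isIdempotentElem_splittingEnd⟩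
  · ext x
    constructor
    · rintro ⟨y, rfl⟩
      exact (splitting y).2
    · intro hx
      exact ⟨x, congrArg Subtype.val (splitting_coe ⟨x, hx⟩)⟩
  · ext x
    constructor
    · intro hx
      exact ⟨x, by
        change x - splittingEnd x = x
        rw [LinearMap.mem_ker.1 hx, sub_zero]⟩
    · rintro ⟨y, rfl⟩
      change (splitting (y - splitting y) : P) = 0
      rw [map_sub, splitting_coe, sub_self, ZeroMemClass.coe_zero]

/-! ### Operators on `A(SL_q(2))` that detect the coinvariants -/

/-- The weights `q, q⁻¹` of the columns of `(T_ij)`. -/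
def weight (j : Fin 2) : ℂ := ![(zeta : ℂ), (zeta : ℂ)⁻¹] j

lemma weight_zero : weight 0 = zeta := rfl

lemma weight_one : weight 1 = (zeta : ℂ)⁻¹ := rfl

lemma weight_zero_mul : weight 0 * weight 1 = 1 := mul_inv_cancel₀ zeta.ne_zero

lemma weight_one_mul : weight 1 * weight 0 = 1 := inv_mul_cancel₀ zeta.ne_zero

/-- The action of the torus on `A(SL_q(2))` by column weights. -/
def torus : P →ₐ[ℂ] P :=
  lift zeta (fun i j => weight j • T zeta i j)
    (by simp only [smul_mul_smul_comm, weight_zero_mul, weight_one_mul, T_ab, one_smul])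
    (by rw [smul_mul_smul_comm, smul_mul_smul_comm, T_ac, smul_comm])
    (by rw [smul_mul_smul_comm, smul_mul_smul_comm, T_bd, smul_comm])
    (by simp only [smul_mul_smul_comm, weight_zero_mul, weight_one_mul, T_cb])
    (by simp only [smul_mul_smul_comm, weight_zero_mul, weight_one_mul, T_cd, one_smul])
    (by simp only [smul_mul_smul_comm, weight_zero_mul, weight_one_mul, T_ad, one_smul])
    (by simp only [smul_mul_smul_comm, weight_one_mul, T_da, one_smul])

lemma torus_T (i j : Fin 2) : torus (T zeta i j) = weight j • T zeta i j := lift_T ..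

/-- A derivation twisted by `torus`. -/
def IsSkewDerivation (E : P →ₗ[ℂ] P) : Prop := ∀ x y, E (x * y) = torus x * E y + E x * y

/-- A two-dimensional representation of `A(SL_q(2))` by upper triangular matrices that factors
through `A(F)` defines a skew derivation that kills the coinvariants. -/
lemma exists_skewDerivation (N : Matrix (Fin 2) (Fin 2) ℂ) (f : P →ₐ[ℂ] Matrix (Fin 2) (Fin 2) ℂ)
    (hf : ∀ i j, f (T zeta i j) = !![(1 : Matrix (Fin 2) (Fin 2) ℂ) i j * weight j, N i j;
      0, (1 : Matrix (Fin 2) (Fin 2) ℂ) i j])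
    (hf' : ∀ i j, f (T zeta i j) ^ 3 =
      algebraMap ℂ _ ((1 : Matrix (Fin 2) (Fin 2) ℂ) i j)) :
    ∃ E : P →ₗ[ℂ] P, IsSkewDerivation E ∧ (∀ i j, E (T zeta i j) = ∑ k, N k j • T zeta i k) ∧
      ∀ p ∈ coinvariants, E p = 0 ∧ torus p = p := by
  let g : AF →ₐ[ℂ] Matrix (Fin 2) (Fin 2) ℂ :=
    Ideal.Quotient.liftₐ ideal.asIdeal f fun x hx => ideal_le_ker f hf' hx
  have hg : ∀ x, g (proj x) = f x := fun x => rfl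
  -- `Φ` is (id ⊗ g) ∘ Δ_R, with the tensor product of P and the 2×2 matrices read as matrices over
  -- P.
  let Φ : P →ₐ[ℂ] Matrix (Fin 2) (Fin 2) P :=
    (Algebra.TensorProduct.lift (Matrix.scalarAlgHom (Fin 2) ℂ)
      ((Algebra.ofId ℂ P).mapMatrix.comp g) fun x y => by
        rw [Matrix.scalarAlgHom_apply, Matrix.scalar_commute_iff]
        ext i j
        simp [Algebra.ofId_apply, Algebra.commutes]).comp coaction
  have hΦT : ∀ i j, Φ (T zeta i j) =
      !![weight j • T zeta i j, ∑ k, N k j • T zeta i k; 0, T zeta i j] := by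
    intro i j
    have h1 : coaction (T zeta i j) = ∑ k, T zeta i k ⊗ₜ[ℂ] proj (T zeta k j) := by
      change Algebra.TensorProduct.map _ _ (comulHom zeta (T zeta i j)) = _
      rw [comulHom_T, map_sum]
      rfl
    simp only [Φ, AlgHom.comp_apply, h1, map_sum, Algebra.TensorProduct.lift_tmul, hg, hf]
    ext k l
    obtain rfl | rfl : j = 0 ∨ j = 1 := by lia
    all_goals fin_cases k <;> fin_cases l <;>
      simp [Fin.sum_univ_two, Matrix.scalar_apply, Algebra.ofId_apply,
        Algebra.algebraMap_eq_smul_one]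
  -- Triangularity makes the diagonal entries multiplicative, so the generators determine them; the
  -- upper right entry is then the skew derivation.
  have hΦ : ∀ x, Φ x 0 0 = torus x ∧ Φ x 1 0 = 0 ∧ Φ x 1 1 = x := by
    intro x
    induction x using induction with
    | hs r => simp [Matrix.algebraMap_matrix_apply]
    | hT i j => simp [hΦT, torus_T]
    | hm x y hx hy => simp [Matrix.mul_apply, Fin.sum_univ_two, hx, hy]
    | ha x y hx hy => simp [hx, hy]
  refine ⟨Matrix.entryLinearMap ℂ P 0 1 ∘ₗ Φ.toLinearMap, fun x y => ?_, fun i j => ?_,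
    fun p hp => ?_⟩
  · simp [Matrix.mul_apply, Fin.sum_univ_two, hΦ]
  · simp [hΦT]
  · have h : Φ p = Matrix.scalar (Fin 2) p := by
      simp only [Φ, AlgHom.comp_apply]
      rw [mem_coinvariants.1 hp, Algebra.TensorProduct.lift_tmul, map_one, mul_one,
        Matrix.scalarAlgHom_apply]
    refine ⟨?_, ?_⟩
    · simp [h, Matrix.scalar_apply]
    · rw [← (hΦ p).1, h]; simp [Matrix.scalar_apply]

lemma exists_raising : ∃ E : P →ₗ[ℂ] P, IsSkewDerivation E ∧
    (E (T zeta 0 0) = 0 ∧ E (T zeta 0 1) = T zeta 0 0 ∧ E (T zeta 1 0) = 0 ∧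
      E (T zeta 1 1) = T zeta 1 0) ∧ ∀ p ∈ coinvariants, E p = 0 ∧ torus p = p := by
  let N : Matrix (Fin 2) (Fin 2) ℂ := !![0, 1; 0, 0]
  obtain ⟨E, h1, h2, h3⟩ := exists_skewDerivation N
    (lift zeta (fun i j => !![(1 : Matrix (Fin 2) (Fin 2) ℂ) i j * weight j, N i j;
      0, (1 : Matrix (Fin 2) (Fin 2) ℂ) i j])
      (by ext k l; fin_cases k <;> fin_cases l <;> simp [N, weight])
      (by ext k l; fin_cases k <;> fin_cases l <;> simp [N, weight])
      (by ext k l; fin_cases k <;> fin_cases l <;> simp [N, weight])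
      (by ext k l; fin_cases k <;> fin_cases l <;> simp [N, weight])
      (by ext k l; fin_cases k <;> fin_cases l <;> simp [N, weight])
      (by simp [N, weight, Matrix.one_fin_two]) (by simp [N, weight, Matrix.one_fin_two]))
    (fun i j => lift_T ..)
    -- The diagonal generators act by diagonal matrices whose entries are cube roots of unity, the
    -- off-diagonal ones by matrices of square zero.
    (fun i j => by
      rw [lift_T, Matrix.algebraMap_eq_diagonal]
      have := zeta_cube
      have := zeta_add
      ext k l
      fin_cases i <;> fin_cases j <;> fin_cases k <;> fin_cases l <;>
        simp [N, weight, pow_succ, Matrix.mul_apply, Fin.sum_univ_two] <;> grind)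
  exact ⟨E, h1, by simp [h2, N], h3⟩

lemma exists_lowering : ∃ E : P →ₗ[ℂ] P, IsSkewDerivation E ∧
    (E (T zeta 0 0) = T zeta 0 1 ∧ E (T zeta 0 1) = 0 ∧ E (T zeta 1 0) = T zeta 1 1 ∧
      E (T zeta 1 1) = 0) ∧ ∀ p ∈ coinvariants, E p = 0 ∧ torus p = p := by
  let N : Matrix (Fin 2) (Fin 2) ℂ := !![0, 0; 1, 0]
  obtain ⟨E, h1, h2, h3⟩ := exists_skewDerivation N
    (lift zeta (fun i j => !![(1 : Matrix (Fin 2) (Fin 2) ℂ) i j * weight j, N i j;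
      0, (1 : Matrix (Fin 2) (Fin 2) ℂ) i j])
      (by ext k l; fin_cases k <;> fin_cases l <;> simp [N, weight])
      (by ext k l; fin_cases k <;> fin_cases l <;> simp [N, weight])
      (by ext k l; fin_cases k <;> fin_cases l <;> simp [N, weight])
      (by ext k l; fin_cases k <;> fin_cases l <;> simp [N, weight])
      (by ext k l; fin_cases k <;> fin_cases l <;> simp [N, weight])
      (by simp [N, weight, Matrix.one_fin_two]) (by simp [N, weight, Matrix.one_fin_two]))
    (fun i j => lift_T ..)
    (fun i j => by
      rw [lift_T, Matrix.algebraMap_eq_diagonal]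
      have := zeta_cube
      have := zeta_add
      ext k l
      fin_cases i <;> fin_cases j <;> fin_cases k <;> fin_cases l <;>
        simp [N, weight, pow_succ, Matrix.mul_apply, Fin.sum_univ_two] <;> grind)
  exact ⟨E, h1, by simp [h2, N], h3⟩

/-! ### The operators on monomials -/

lemma geom_sum_eq_zero_iff {v : ℂ} (hv : IsPrimitiveRoot v 3) (n : ℕ) :
    ∑ i ∈ Finset.range n, v ^ i = 0 ↔ 3 ∣ n := by
  have h := mul_geom_sum v n
  have h1 : v - 1 ≠ 0 := sub_ne_zero.2 (hv.ne_one (by norm_num))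
  rw [← hv.pow_eq_one_iff_dvd, ← sub_eq_zero (a := v ^ n), ← h, mul_eq_zero, or_iff_right h1]

lemma zeta_sq_primitive : IsPrimitiveRoot ((zeta : ℂ) ^ 2) 3 :=
  zeta_primitive.pow_of_coprime 2 (by norm_num)

lemma torus_mon (n : ℤ) (r t : ℕ) :
    torus (mon zeta (n, r, t)) = (zeta : ℂ) ^ (n + t - r) • mon zeta (n, r, t) := by
  have hq := zeta.ne_zero
  simp only [mon, map_mul, map_pow, torus_T, smul_pow, smul_mul_smul_comm, weight_zero, weight_one]
  congr 1
  rw [← zpow_neg_one, ← zpow_natCast, ← zpow_natCast, ← zpow_natCast, ← zpow_natCast, ← zpow_mul,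
    ← zpow_mul, ← zpow_add₀ hq, ← zpow_add₀ hq, ← zpow_add₀ hq]
  congr 1
  lia

namespace IsSkewDerivation

lemma map_one {E : P →ₗ[ℂ] P} (hE : IsSkewDerivation E) : E 1 = 0 := by
  simpa using hE 1 1

lemma map_pow_eq_zero {E : P →ₗ[ℂ] P} (hE : IsSkewDerivation E) {x : P} (hx : E x = 0) (n : ℕ) :
    E (x ^ n) = 0 := by
  induction n with
  | zero => rw [pow_zero, hE.map_one]
  | succ n ih => rw [pow_succ, hE, hx, ih, mul_zero, zero_mul, add_zero]

/-- In each term of the Leibniz expansion, every x to the left of y contributes w from `torus` and k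
from the exchange with y. The sum is therefore a q-integer in v = wk, and at a primitive cube root
of unity v it vanishes exactly when 3 divides the exponent (`geom_sum_eq_zero_iff`). -/
lemma map_pow_succ {E : P →ₗ[ℂ] P} (hE : IsSkewDerivation E) {x y : P} {w k v : ℂ} (hx : E x = y)
    (hw : torus x = w • x) (hk : x * y = k • (y * x)) (hv : w * k = v) (n : ℕ) :
    E (x ^ (n + 1)) = (∑ i ∈ Finset.range (n + 1), v ^ i) • (y * x ^ n) := by
  induction n with
  | zero => simp [hx]
  | succ n ih =>
    rw [pow_succ' x (n + 1), hE, ih, hx, hw, geom_sum_succ' (n := n + 1), mul_smul_comm,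
      smul_mul_assoc, ← mul_assoc, hk, smul_mul_assoc, smul_smul, smul_smul, mul_assoc, hv,
      mul_assoc y,
      ← pow_succ']
    have h := geom_sum_succ (x := v) (n := n + 1)
    rw [← geom_sum_succ', h, add_smul, one_smul, mul_comm v]

lemma map_mul_right {E : P →ₗ[ℂ] P} (hE : IsSkewDerivation E) {y : P} (hy : E y = 0) (x : P) :
    E (x * y) = E x * y := by rw [hE, hy, mul_zero, zero_add]

lemma map_mul_left {E : P →ₗ[ℂ] P} (hE : IsSkewDerivation E) {x : P} (hx : E x = 0) (y : P) :
    E (x * y) = torus x * E y := by rw [hE, hx, zero_mul, add_zero]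

end IsSkewDerivation

lemma torus_pow (i j : Fin 2) (n : ℕ) :
    torus (T zeta i j ^ n) = weight j ^ n • T zeta i j ^ n := by
  rw [map_pow, torus_T, smul_pow]

lemma weight_ne_zero (j : Fin 2) : weight j ≠ 0 := by
  fin_cases j
  exacts [zeta.ne_zero, inv_ne_zero zeta.ne_zero]

section raising

variable {E : P →ₗ[ℂ] P}

lemma raising_bc (hE : IsSkewDerivation E) (hb : E (T zeta 0 1) = T zeta 0 0)
    (hc : E (T zeta 1 0) = 0) (r t : ℕ) :
    E (T zeta 0 1 ^ r * T zeta 1 0 ^ t) = (∑ i ∈ Finset.range r, (zeta : ℂ) ^ i) •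
      (T zeta 0 0 * (T zeta 0 1 ^ (r - 1) * T zeta 1 0 ^ t)) := by
  rw [hE.map_mul_right (hE.map_pow_eq_zero hc t)]
  cases r with
  | zero => simp [hE.map_one]
  | succ r =>
    rw [hE.map_pow_succ hb (torus_T 0 1) (T_ba zeta) (v := zeta), smul_mul_assoc, mul_assoc,
      Nat.add_sub_cancel]
    rw [weight_one, zeta_inv]; linear_combination (zeta : ℂ) * zeta_cube

/-- For n < 0 the generator `a` created from b^r meets a `d` and yields a second term, to which the
derivative of the power of `d` also contributes. Only the vanishing of l for n ≥ 0 and the zeros of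
k matter later. -/
lemma raising_mon (hE : IsSkewDerivation E) (ha : E (T zeta 0 0) = 0)
    (hb : E (T zeta 0 1) = T zeta 0 0) (hc : E (T zeta 1 0) = 0) (hd : E (T zeta 1 1) = T zeta 1 0)
    (n : ℤ) (r t : ℕ) : ∃ k l : ℂ, (k = 0 ↔ 3 ∣ r) ∧ (0 ≤ n → l = 0) ∧
      E (mon zeta (n, r, t)) =
        k • mon zeta (n + 1, r - 1, t) + l • mon zeta (n + 1, r, t + 1) := by
  have hbc := raising_bc hE hb hc r t
  have hg := geom_sum_eq_zero_iff zeta_primitive r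
  set e := ∑ i ∈ Finset.range r, (zeta : ℂ) ^ i with he
  have hq := zeta.ne_zero
  induction n using int_cases with
  | h₁ n =>
    refine ⟨weight 0 ^ n * e, 0, ?_, fun _ => rfl, ?_⟩
    · rw [mul_eq_zero, or_iff_right (pow_ne_zero _ (weight_ne_zero 0)), hg]
    · rw [mon_natCast, hE.map_mul_left (hE.map_pow_eq_zero ha n), hbc, torus_pow,
        smul_mul_smul_comm, ← Nat.cast_add_one, mon_natCast, zero_smul, add_zero, pow_succ,
        mul_assoc]
  | h₂ n =>
    have h1 : ∃ u : ℂ, torus (T zeta 0 1 ^ r * T zeta 1 0 ^ t) =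
        u • (T zeta 0 1 ^ r * T zeta 1 0 ^ t) := by
      have := torus_mon 0 r t
      simp only [mon, Int.toNat_zero, neg_zero, pow_zero, one_mul, mul_one] at this
      exact ⟨_, this⟩
    obtain ⟨u, hu⟩ := h1
    obtain ⟨f, hf⟩ : ∃ f : ℂ, E (T zeta 1 1 ^ (n + 1)) = f • (T zeta 1 0 * T zeta 1 1 ^ n) :=
      ⟨_, hE.map_pow_succ hd (torus_T 1 1) (T_dc zeta) rfl n⟩
    have hn : -((n + 1 : ℕ) : ℤ) + 1 = -(n : ℤ) := by push_cast; ring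
    have hA : E (mon zeta (-((n + 1 : ℕ) : ℤ), r, t)) = (u * f) • mon zeta (-(n : ℤ), r, t + 1) +
        e • (T zeta 0 0 * mon zeta (-((n + 1 : ℕ) : ℤ), r - 1, t)) := by
      rw [mon_neg_natCast, mon_neg_natCast, mon_neg_natCast, hE, hu, hf, smul_mul_smul_comm, hbc,
        smul_mul_assoc, mul_assoc (T zeta 0 0), ← mul_assoc _ (T zeta 1 0),
        mul_assoc _ _ (T zeta 1 0),
        ← pow_succ]
    rw [a_mul_mon_of_neg _ (by lia), hn] at hA
    refine ⟨e * (zeta : ℂ) ^ (r - 1 + t), u * f + e * (zeta : ℂ) ^ (r - 1 + t + 1), ?_, by lia, ?_⟩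
    · rw [mul_eq_zero, or_iff_left (pow_ne_zero _ hq), hg]
    · rw [hA, hn]
      -- For r = 0 the truncated r - 1 is harmless, since e = 0.
      cases r with
      | zero => simp [he]
      | succ r =>
        rw [Nat.add_sub_cancel]
        module

end raising

section lowering

variable {E : P →ₗ[ℂ] P}

lemma lowering_bc (hE : IsSkewDerivation E) (hb : E (T zeta 0 1) = 0)
    (hc : E (T zeta 1 0) = T zeta 1 1) (r t : ℕ) :
    E (T zeta 0 1 ^ r * T zeta 1 0 ^ t) = (∑ i ∈ Finset.range t, ((zeta : ℂ) ^ 2) ^ i) •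
      (T zeta 1 1 * (T zeta 0 1 ^ r * T zeta 1 0 ^ (t - 1))) := by
  rw [hE.map_mul_left (hE.map_pow_eq_zero hb r)]
  cases t with
  | zero => simp [hE.map_one]
  | succ t =>
    rw [hE.map_pow_succ hc (torus_T 1 0) (T_cd zeta) (v := (zeta : ℂ) ^ 2), mul_smul_comm,
      Nat.add_sub_cancel, torus_pow, smul_mul_assoc, ← mul_assoc, ← mul_assoc,
      pow_mul_of_skew (T_bd zeta), smul_mul_assoc, smul_smul, weight_one, smul_smul,
      mul_assoc (Finset.sum _ _), ← mul_pow, inv_mul_cancel₀ zeta.ne_zero, one_pow, mul_one]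
    rw [weight_zero, sq]

/-- The mirror image of `raising_mon`: c takes the part of b, and the second term appears only for n
> 0, through ad = 1 + q bc. -/
lemma lowering_mon (hE : IsSkewDerivation E) (ha : E (T zeta 0 0) = T zeta 0 1)
    (hb : E (T zeta 0 1) = 0) (hc : E (T zeta 1 0) = T zeta 1 1) (hd : E (T zeta 1 1) = 0)
    (n : ℤ) (r t : ℕ) : ∃ k l : ℂ, (k = 0 ↔ 3 ∣ t) ∧ (n ≤ 0 → l = 0) ∧
      E (mon zeta (n, r, t)) =
        k • mon zeta (n - 1, r, t - 1) + l • mon zeta (n - 1, r + 1, t) := by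
  have hbc := lowering_bc hE hb hc r t
  have hg := geom_sum_eq_zero_iff zeta_sq_primitive t
  set e := ∑ i ∈ Finset.range t, ((zeta : ℂ) ^ 2) ^ i with he
  have hq := zeta.ne_zero
  induction n using int_cases' with
  | h₁ n =>
    obtain ⟨f, hf⟩ : ∃ f : ℂ, E (T zeta 0 0 ^ (n + 1)) = f • (T zeta 0 1 * T zeta 0 0 ^ n) :=
      ⟨_, hE.map_pow_succ ha (torus_T 0 0) (T_ab zeta) rfl n⟩
    obtain ⟨k, -, -, hk⟩ := b_mul_mon zeta n r t
    have hn : ((n + 1 : ℕ) : ℤ) - 1 = n := by push_cast; ring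
    have hA : E (mon zeta ((n + 1 : ℕ), r, t)) = (weight 0 ^ (n + 1) * e) •
        (mon zeta (n, r, t - 1) + (zeta : ℂ) • mon zeta (n, r + 1, t - 1 + 1)) +
        f • (T zeta 0 1 * mon zeta (n, r, t)) := by
      rw [mon_natCast, mon_natCast, mon_natCast, mon_natCast, hE, hf, hbc, torus_pow,
        smul_mul_smul_comm, smul_mul_assoc, mul_assoc (T zeta 0 1), pow_succ (T zeta 0 0),
        mul_assoc _ (T zeta 0 0),
        ← mul_assoc (T zeta 0 0), T_ad, add_mul, one_mul, smul_mul_assoc, mul_assoc (T zeta 0 1),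
        c_mul_bc, b_mul_bc, mul_add, mul_smul_comm]
    refine ⟨weight 0 ^ (n + 1) * e, weight 0 ^ (n + 1) * e * zeta + f * k, ?_, by lia, ?_⟩
    · rw [mul_eq_zero, or_iff_right (pow_ne_zero _ (weight_ne_zero 0)), hg]
    · rw [hA, hn, hk]
      cases t with
      | zero => simp [he, smul_smul]
      | succ t =>
        rw [Nat.add_sub_cancel]
        module
  | h₂ n =>
    refine ⟨e * (zeta : ℂ)⁻¹ ^ (r + (t - 1)), 0, ?_, fun _ => rfl, ?_⟩
    · rw [mul_eq_zero, or_iff_left (pow_ne_zero _ (inv_ne_zero hq)), hg]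
    · rw [mon_neg_natCast, hE.map_mul_right (hE.map_pow_eq_zero hd n), hbc, smul_mul_assoc,
        mul_assoc, ← mon_neg_natCast, d_mul_mon_of_nonpos _ (by lia), smul_smul, zero_smul,
        add_zero]

end lowering

/-! ### The coinvariants -/

/-- The coefficients of an element with respect to the monomials. -/
def monCoeff (i : ℤ × ℕ × ℕ) : P →ₗ[ℂ] ℂ := (monBasis zeta).coord i

lemma monCoeff_mon (i j : ℤ × ℕ × ℕ) : monCoeff i (mon zeta j) = if j = i then 1 else 0 := by
  rw [monCoeff, ← monBasis_apply, Module.Basis.coord_apply, Module.Basis.repr_self,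
    Finsupp.single_apply]

/-- At most two monomials contribute to a given coefficient of E x. The hypothesis `hk` discards the
spurious term that truncated subtraction would produce at r = 0. -/
lemma monCoeff_raising {E : P →ₗ[ℂ] P} {k l : ℤ → ℕ → ℕ → ℂ} (hk : ∀ n t, k n 0 t = 0)
    (h : ∀ n r t, E (mon zeta (n, r, t)) =
      k n r t • mon zeta (n + 1, r - 1, t) + l n r t • mon zeta (n + 1, r, t + 1))
    (n : ℤ) (r t : ℕ) (x : P) :
    monCoeff (n + 1, r, t) (E x) = k n (r + 1) t * monCoeff (n, r + 1, t) x +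
      if t = 0 then 0 else l n r (t - 1) * monCoeff (n, r, t - 1) x := by
  have : monCoeff (n + 1, r, t) ∘ₗ E = k n (r + 1) t • monCoeff (n, r + 1, t) +
      if t = 0 then 0 else l n r (t - 1) • monCoeff (n, r, t - 1) := by
    refine (monBasis zeta).ext fun ⟨n', r', t'⟩ => ?_
    rw [monBasis_apply, LinearMap.comp_apply, h]
    simp only [map_add, map_smul, LinearMap.add_apply, LinearMap.smul_apply, apply_ite DFunLike.coe,
      ite_apply]
    clear h
    cases r' <;> cases t <;>
      simp only [monCoeff_mon, Prod.mk.injEq, LinearMap.zero_apply, smul_eq_mul] <;> grind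
  have h := LinearMap.congr_fun this x
  split_ifs at h ⊢ <;> simpa using h

lemma monCoeff_lowering {E : P →ₗ[ℂ] P} {k l : ℤ → ℕ → ℕ → ℂ} (hk : ∀ n r, k n r 0 = 0)
    (h : ∀ n r t, E (mon zeta (n, r, t)) =
      k n r t • mon zeta (n - 1, r, t - 1) + l n r t • mon zeta (n - 1, r + 1, t))
    (n : ℤ) (r t : ℕ) (x : P) :
    monCoeff (n - 1, r, t) (E x) = k n r (t + 1) * monCoeff (n, r, t + 1) x +
      if r = 0 then 0 else l n (r - 1) t * monCoeff (n, r - 1, t) x := by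
  have : monCoeff (n - 1, r, t) ∘ₗ E = k n r (t + 1) • monCoeff (n, r, t + 1) +
      if r = 0 then 0 else l n (r - 1) t • monCoeff (n, r - 1, t) := by
    refine (monBasis zeta).ext fun ⟨n', r', t'⟩ => ?_
    rw [monBasis_apply, LinearMap.comp_apply, h]
    simp only [map_add, map_smul, LinearMap.add_apply, LinearMap.smul_apply, apply_ite DFunLike.coe,
      ite_apply]
    clear h
    cases t' <;> cases r <;>
      simp only [monCoeff_mon, Prod.mk.injEq, LinearMap.zero_apply, smul_eq_mul] <;> grind
  have h := LinearMap.congr_fun this x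
  split_ifs at h ⊢ <;> simpa using h

lemma monCoeff_torus (n : ℤ) (r t : ℕ) (x : P) : monCoeff (n, r, t) (torus x) =
    (zeta : ℂ) ^ (n + t - r) * monCoeff (n, r, t) x := by
  have : monCoeff (n, r, t) ∘ₗ torus.toLinearMap =
      (zeta : ℂ) ^ (n + t - r) • monCoeff (n, r, t) := by
    refine (monBasis zeta).ext fun ⟨n', r', t'⟩ => ?_
    rw [monBasis_apply, LinearMap.comp_apply, AlgHom.toLinearMap_apply, torus_mon, map_smul,
      LinearMap.smul_apply, monCoeff_mon]
    split_ifs with h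
    · simp only [Prod.mk.injEq] at h
      rw [h.1, h.2.1, h.2.2]
    · simp
  exact LinearMap.congr_fun this x

lemma triple_of_mem_coinvariants {p : P} (hp : p ∈ coinvariants) {i : ℤ × ℕ × ℕ}
    (hi : monCoeff i p ≠ 0) : Triple i := by
  obtain ⟨E, hE, ⟨ha, hb, hc, hd⟩, hinv⟩ := exists_raising
  obtain ⟨E', hE', ⟨ha', hb', hc', hd'⟩, hinv'⟩ := exists_lowering
  choose k l hk hl hmon using raising_mon hE ha hb hc hd
  choose k' l' hk' hl' hmon' using lowering_mon hE' ha' hb' hc' hd'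
  have hR := fun n r t => monCoeff_raising (fun n t => (hk n 0 t).2 (dvd_zero 3)) hmon n r t p
  have hL := fun n r t => monCoeff_lowering (fun n r => (hk' n r 0).2 (dvd_zero 3)) hmon' n r t p
  rw [(hinv p hp).1] at hR
  rw [(hinv' p hp).1] at hL
  simp only [map_zero] at hR hL
  -- For n ≥ 0 the second term of the raising recursion is absent, so a nonzero coefficient at r + 1
  -- forces the q-integer k to vanish.
  have hr : ∀ n : ℤ, 0 ≤ n → ∀ r t, monCoeff (n, r, t) p ≠ 0 → 3 ∣ r := by
    intro n hn r t h
    cases r with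
    | zero => exact dvd_zero 3
    | succ r =>
      have h4 := hR n r t
      rw [hl n _ _ hn, zero_mul, ite_self, add_zero, eq_comm, mul_eq_zero, or_iff_left h] at h4
      exact (hk ..).1 h4
  have ht : ∀ n : ℤ, n ≤ 0 → ∀ r t, monCoeff (n, r, t) p ≠ 0 → 3 ∣ t := by
    intro n hn r t h
    cases t with
    | zero => exact dvd_zero 3
    | succ t =>
      have h4 := hL n r t
      rw [hl' n _ _ hn, zero_mul, ite_self, add_zero, eq_comm, mul_eq_zero, or_iff_left h] at h4
      exact (hk' ..).1 h4
  have ht' : ∀ n : ℤ, 0 ≤ n → ∀ r t, monCoeff (n, r, t) p ≠ 0 → 3 ∣ t := by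
    intro n hn r t h
    have h3 := hr n hn r t h
    cases t with
    | zero => exact dvd_zero 3
    | succ t =>
      -- The neighbouring coefficient has b-exponent r - 1. As 3 divides r, it does not divide r -
      -- 1, so by `hr` that coefficient is zero.
      have h0 : (if r = 0 then 0 else l' n (r - 1) t * monCoeff (n, r - 1, t) p) = 0 := by
        split_ifs with h1
        · rfl
        · by_contra h2
          have := hr n hn (r - 1) t (right_ne_zero_of_mul h2)
          lia
      have h4 := hL n r t
      rw [h0, add_zero, eq_comm, mul_eq_zero, or_iff_left h] at h4
      exact (hk' ..).1 h4
  have hr' : ∀ n : ℤ, n ≤ 0 → ∀ r t, monCoeff (n, r, t) p ≠ 0 → 3 ∣ r := by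
    intro n hn r t h
    have h3 := ht n hn r t h
    cases r with
    | zero => exact dvd_zero 3
    | succ r =>
      have h0 : (if t = 0 then 0 else l n r (t - 1) * monCoeff (n, r, t - 1) p) = 0 := by
        split_ifs with h1
        · rfl
        · by_contra h2
          have := ht n hn r (t - 1) (right_ne_zero_of_mul h2)
          lia
      have h4 := hR n r t
      rw [h0, add_zero, eq_comm, mul_eq_zero, or_iff_left h] at h4
      exact (hk ..).1 h4
  obtain ⟨n, r, t⟩ := i
  -- Invariance under `torus` gives 3 ∣ n + t - r, hence 3 ∣ n once r and t are multiples of 3.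
  have hw := monCoeff_torus n r t p
  rw [(hinv p hp).2, eq_comm, mul_eq_right₀ hi, zeta_primitive.zpow_eq_one_iff_dvd] at hw
  obtain hn | hn := le_total 0 n
  · have h1 := hr n hn r t hi
    have h2 := ht' n hn r t hi
    simp only [Triple]
    lia
  · have h1 := hr' n hn r t hi
    have h2 := ht n hn r t hi
    simp only [Triple]
    lia

lemma coinvariants_le : coinvariants ≤ frobenius.range := by
  intro p hp
  rw [← (monBasis zeta).linearCombination_repr p, Finsupp.linearCombination_apply]
  refine sum_mem fun i hi => Subalgebra.smul_mem _ ?_ _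
  rw [monBasis_apply]
  exact (triple_of_mem_coinvariants hp (Finsupp.mem_support_iff.1 hi)).mon_mem

/-- The q-binomial formula gives Δ(T_ij³) = ∑ₖ T_ik³ ⊗ T_kj³, and the projection turns T_kj³ into
δ_kj. -/
lemma cube_mem_coinvariants (i j : Fin 2) : T zeta i j ^ 3 ∈ coinvariants := by
  rw [mem_coinvariants, map_pow]
  change (Algebra.TensorProduct.map (AlgHom.id ℂ P) proj) (comulHom zeta (T zeta i j)) ^ 3 = _
  rw [← map_pow, comul_T_cube, map_sum]
  simp only [Algebra.TensorProduct.map_tmul, map_pow, proj_T_cube, AlgHom.id_apply]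
  obtain rfl | rfl : j = 0 ∨ j = 1 := by lia
  all_goals simp

lemma range_frobenius_le : frobenius.range ≤ coinvariants := by
  intro x hx
  obtain ⟨y, rfl⟩ := mem_range_frobenius.1 hx
  have h : ∀ y, cubeHom y ∈ coinvariants := by
    intro y
    induction y using induction with
    | hs r => rw [AlgHom.commutes]; exact Subalgebra.algebraMap_mem _ r
    | hT i j => rw [cubeHom_T]; exact cube_mem_coinvariants i j
    | hm y z hy hz => rw [map_mul]; exact mul_mem hy hz
    | ha y z hy hz => rw [map_add]; exact add_mem hy hz
  exact h y

end QuantumSL2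

end

open QuantumSL2 in
theorem proposition3p4 :
    ∃ Fr : polyFun →ₐ[ℂ] P,
      -- the Frobenius map exists and is determined by its values on the generators
      IsFrobenius Fr ∧ (∀ Fr' : polyFun →ₐ[ℂ] P, IsFrobenius Fr' → Fr' = Fr) ∧
      -- it is an isomorphism onto the subalgebra of right coinvariants
      Function.Injective Fr ∧ Fr.range = coinvariants ∧
      -- the formulas for the splitting define a unique linear map
      ∃ s : P →ₗ[ℂ] Fr.range,
        IsSplitting Fr.range s ∧ (∀ s' : P →ₗ[ℂ] Fr.range, IsSplitting Fr.range s' → s' = s) ∧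
        -- which is a unital homomorphism of (left and right) modules over the image of Fr
        s 1 = 1 ∧
        (∀ (f : Fr.range) (x : P), s ((f : P) * x) = f * s x) ∧
        (∀ (f : Fr.range) (x : P), s (x * (f : P)) = s x * f) ∧
        -- and so the image of Fr is a direct summand, with complement the image of id - s
        ∃ M N : Submodule Fr.range P,
          (M : Set P) = Fr.range ∧ (N : Set P) = Set.range (fun x : P => x - (s x : P)) ∧
          IsCompl M N :=
  ⟨frobenius, isFrobenius_frobenius, fun _ h => h.eq_frobenius, frobenius_injective,
    le_antisymm range_frobenius_le coinvariants_le, splitting, isSplitting_splitting,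
    fun _ h => h.eq isSplitting_splitting, splitting_one, splitting_mul, mul_splitting,
    exists_isCompl_splitting⟩
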